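/- Let $\mathbb{BC}=\{Z=z_1+jz_2:\ z_1,z_2\in\mathbb C\}$ be the commutative algebra of bicomplex numbers ($j^2=-1$, $ij=ji$), with Euclidean norm $|Z|^2=|z_1|^2+|z_2|^2$, conjugation $Z^*=\overline{z_1}-j\,\overline{z_2}$, Lebesgue measure $\lambda$ on $\mathbb{BC}\cong\mathbb R^4$, idempotents $e_\pm=\frac{1\pm ij}{2}$, idempotent coordinates $Z=\alpha e_++\beta e_-$ with $\alpha=z_1-iz_2$, $\beta=z_1+iz_2$, and exponential $e^Z=e^\alpha e_++e^\beta e_-$. A function $f:\mathbb{BC}\to\mathbb{BC}$ is bicomplex holomorphic if at every $Z$ the quotient $(f(Z+H)-f(Z))/H$ has a limit in $\mathbb{BC}$ as $H\to0$ through invertible $H$. Let $\sigma,\nu>0$. Let $L^{2,\sigma}_{\mathbb{BC}}(\mathbb R)$ be the $\mathbb{BC}$-module of (classes of) measurable functions $\varphi:\mathbb R\to\mathbb{BC}$ that are square integrable for the probability measure $(\sigma/\pi)^{1/2}e^{-\sigma x^2}dx$, and let $\mathcal F^{2,\nu}(\mathbb{BC})$ be the $\mathbb{BC}$-module of bicomplex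 holomorphic functions that are square integrable for the probability measure $(\nu/\pi)^2e^{-\nu|Z|^2}d\lambda(Z)$. Both carry the $\mathbb{BC}$-valued inner product $\langle f,g\rangle=\int f g^*\,d\mu$ and the norm $\|f\|^2=\int|f|^2\,d\mu$, where $\mu$ is the respective probability measure. The bicomplex Segal–Bargmann transform $$\mathcal B^{\sigma,\nu}_{\mathbb{BC}}(\varphi)(Z)=\Big(\frac{\sigma}{\pi}\Big)^{1/2}\int_{\mathbb R}e^{-\sigma\left(x-\sqrt{\nu/(4\sigma)}\,Z\right)^2}\varphi(x)\,dx$$ is defined by an absolutely convergent integral for every $\varphi\in L^{2,\sigma}_{\mathbb{BC}}(\mathbb R)$ and $Z\in\mathbb{BC}$, and it is a $\mathbb{BC}$-linear bijection of $L^{2,\sigma}_{\mathbb{BC}}(\mathbb R)$ onto $\mathcal F^{2,\nu}(\mathbb{BC})$. Its inverse $[\mathcal B^{\sigma,\nu}_{\mathbb{BC}}]^{-1}:\mathcal F^{2,\nu}(\mathbb{BC})\to L^{2,\sigma}_{\mathbb{BC}}(\mathbb R)$ is unitary, that is, it preserves the $\mathbb{BC}$-valued inner product and the norm, and it has the integral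 representation $$[\mathcal B^{\sigma,\nu}_{\mathbb{BC}}]^{-1}(f)(x)=\Big(\frac{\nu}{\pi}\Big)^{2}\int_{\mathbb{BC}}e^{-\nu|Z|^2-\frac{\nu}{4}(Z^*)^2+\sqrt{\sigma\nu}\,x\,Z^*}f(Z)\,d\lambda(Z),\qquad f\in\mathcal F^{2,\nu}(\mathbb{BC}),$$ in the following sense. (i) For every $f\in\mathcal F^{2,\nu}(\mathbb{BC})$ the integral is the limit in the mean, in the norm of $L^{2,\sigma}_{\mathbb{BC}}(\mathbb R)$ as $R\to\infty$, of the absolutely convergent integrals over the balls $|Z|<R$, each of which is, as a function of $x$, square integrable for $(\sigma/\pi)^{1/2}e^{-\sigma x^2}dx$. (ii) For every $f\in\mathcal F^{2,\nu}(\mathbb{BC})$ the formula holds as an ordinary Lebesgue integral for almost every $x\in\mathbb R$ among those for which the integral converges absolutely. (iii) The functions $f\in\mathcal F^{2,\nu}(\mathbb{BC})$ for which the integral converges absolutely at every $x\in\mathbb R$ are dense in $\mathcal F^{2,\nu}(\mathbb{BC})$. -/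

import Mathlib

open MeasureTheory Filter Topology

noncomputable section

/-- Bicomplex numbers `Z = z₁ + j z₂` with `z₁ z₂ : ℂ`, carrying the Euclidean norm of `ℝ⁴`,
`|Z|² = |z₁|² + |z₂|²`. -/
def Bicomplex : Type := WithLp 2 (ℂ × ℂ)

namespace Bicomplex

instance : NormedAddCommGroup Bicomplex := inferInstanceAs (NormedAddCommGroup (WithLp 2 (ℂ × ℂ)))
instance : InnerProductSpace ℂ Bicomplex := inferInstanceAs (InnerProductSpace ℂ (WithLp 2 (ℂ × ℂ)))
instance : InnerProductSpace ℝ Bicomplex := inferInstanceAs (InnerProductSpace ℝ (WithLp 2 (ℂ × ℂ)))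
instance : IsScalarTower ℝ ℂ Bicomplex := inferInstanceAs (IsScalarTower ℝ ℂ (WithLp 2 (ℂ × ℂ)))
instance : FiniteDimensional ℂ Bicomplex :=
  inferInstanceAs (FiniteDimensional ℂ (WithLp 2 (ℂ × ℂ)))
instance : FiniteDimensional ℝ Bicomplex :=
  inferInstanceAs (FiniteDimensional ℝ (WithLp 2 (ℂ × ℂ)))
instance : MeasurableSpace Bicomplex := inferInstanceAs (MeasurableSpace (WithLp 2 (ℂ × ℂ)))
instance : BorelSpace Bicomplex := inferInstanceAs (BorelSpace (WithLp 2 (ℂ × ℂ)))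
/-- Lebesgue measure on `ℝ⁴`, in the real and imaginary parts of `z₁` and `z₂`. -/
instance : MeasureSpace Bicomplex := inferInstanceAs (MeasureSpace (WithLp 2 (ℂ × ℂ)))

/-- The bicomplex number `z₁ + j z₂`. -/
def mk (z₁ z₂ : ℂ) : Bicomplex := WithLp.toLp 2 (z₁, z₂)

/-- The component `z₁` of `z₁ + j z₂`. -/
def z₁ (Z : Bicomplex) : ℂ := (WithLp.ofLp Z).1

/-- The component `z₂` of `z₁ + j z₂`. -/
def z₂ (Z : Bicomplex) : ℂ := (WithLp.ofLp Z).2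

@[ext] theorem ext {Z W : Bicomplex} (h₁ : Z.z₁ = W.z₁) (h₂ : Z.z₂ = W.z₂) : Z = W :=
  WithLp.ofLp_injective 2 (Prod.ext h₁ h₂)

@[simp] theorem z₁_mk (a b : ℂ) : (mk a b).z₁ = a := rfl
@[simp] theorem z₂_mk (a b : ℂ) : (mk a b).z₂ = b := rfl
@[simp] theorem z₁_add (Z W : Bicomplex) : (Z + W).z₁ = Z.z₁ + W.z₁ := rfl
@[simp] theorem z₂_add (Z W : Bicomplex) : (Z + W).z₂ = Z.z₂ + W.z₂ := rfl
@[simp] theorem z₁_zero : (0 : Bicomplex).z₁ = 0 := rfl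
@[simp] theorem z₂_zero : (0 : Bicomplex).z₂ = 0 := rfl
@[simp] theorem z₁_smul (c : ℂ) (Z : Bicomplex) : (c • Z).z₁ = c * Z.z₁ := rfl
@[simp] theorem z₂_smul (c : ℂ) (Z : Bicomplex) : (c • Z).z₂ = c * Z.z₂ := rfl

/-- `(z₁ + j z₂)(w₁ + j w₂) = (z₁ w₁ - z₂ w₂) + j (z₁ w₂ + z₂ w₁)`, i.e. `j² = -1`, `ij = ji`. -/
instance : Mul Bicomplex := ⟨fun Z W => mk (Z.z₁ * W.z₁ - Z.z₂ * W.z₂) (Z.z₁ * W.z₂ + Z.z₂ * W.z₁)⟩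
instance : One Bicomplex := ⟨mk 1 0⟩

@[simp] theorem z₁_mul (Z W : Bicomplex) : (Z * W).z₁ = Z.z₁ * W.z₁ - Z.z₂ * W.z₂ := rfl
@[simp] theorem z₂_mul (Z W : Bicomplex) : (Z * W).z₂ = Z.z₁ * W.z₂ + Z.z₂ * W.z₁ := rfl
@[simp] theorem z₁_one : (1 : Bicomplex).z₁ = 1 := rfl
@[simp] theorem z₂_one : (1 : Bicomplex).z₂ = 0 := rfl

instance : CommRing Bicomplex :=
  { (inferInstance : AddCommGroup Bicomplex) with
    mul := (· * ·)
    one := 1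
    left_distrib := fun a b c => by ext <;> simp <;> ring
    right_distrib := fun a b c => by ext <;> simp <;> ring
    zero_mul := fun a => by ext <;> simp
    mul_zero := fun a => by ext <;> simp
    mul_assoc := fun a b c => by ext <;> simp <;> ring
    one_mul := fun a => by ext <;> simp
    mul_one := fun a => by ext <;> simp
    mul_comm := fun a b => by ext <;> simp <;> ring }

theorem continuous_z₁ : Continuous z₁ :=
  continuous_fst.comp (WithLp.prod_continuous_ofLp 2 ℂ ℂ)

theorem continuous_z₂ : Continuous z₂ :=
  continuous_snd.comp (WithLp.prod_continuous_ofLp 2 ℂ ℂ)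

instance : ContinuousMul Bicomplex where
  continuous_mul := by
    have h : Continuous fun p : Bicomplex × Bicomplex =>
        (p.1.z₁ * p.2.z₁ - p.1.z₂ * p.2.z₂, p.1.z₁ * p.2.z₂ + p.1.z₂ * p.2.z₁) := by
      have := continuous_z₁
      have := continuous_z₂
      fun_prop
    exact (WithLp.prod_continuous_toLp 2 ℂ ℂ).comp h

/-- Multiplication by a fixed bicomplex number, as a `ℂ`-linear map. -/
def mulLeft (A : Bicomplex) : Bicomplex →ₗ[ℂ] Bicomplex where
  toFun Z := A * Z
  map_add' Z W := mul_add A Z W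
  map_smul' c Z := by ext <;> simp <;> ring

/-- The conjugate `Z† = z₁ - j z₂`. -/
def dag (Z : Bicomplex) : Bicomplex := mk Z.z₁ (-Z.z₂)

/-- The conjugate `Z* = conj z₁ - j conj z₂`. -/
def conj (Z : Bicomplex) : Bicomplex :=
  mk ((starRingEnd ℂ) Z.z₁) (-(starRingEnd ℂ) Z.z₂)

/-- The idempotent `e₊ = (1 + ij) / 2`. -/
def ePlus : Bicomplex := mk (1 / 2) (Complex.I / 2)

/-- The idempotent `e₋ = (1 - ij) / 2`. -/
def eMinus : Bicomplex := mk (1 / 2) (-Complex.I / 2)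

/-- The idempotent coordinate `α = z₁ - i z₂` in `Z = α e₊ + β e₋`. -/
def alpha (Z : Bicomplex) : ℂ := Z.z₁ - Complex.I * Z.z₂

/-- The idempotent coordinate `β = z₁ + i z₂` in `Z = α e₊ + β e₋`. -/
def beta (Z : Bicomplex) : ℂ := Z.z₁ + Complex.I * Z.z₂

/-- The bicomplex exponential `e^Z = e^α e₊ + e^β e₋`. -/
def exp (Z : Bicomplex) : Bicomplex :=
  Complex.exp Z.alpha • ePlus + Complex.exp Z.beta • eMinus

/-- The null cone `z₁² + z₂² = 0`: the non-invertible bicomplex numbers. -/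
def nullCone : Set Bicomplex := {Z | Z.z₁ ^ 2 + Z.z₂ ^ 2 = 0}

/-- The inverse `Z† / (z₁² + z₂²)` of a bicomplex number off the null cone. -/
def inv (Z : Bicomplex) : Bicomplex := (Z.z₁ ^ 2 + Z.z₂ ^ 2)⁻¹ • Z.dag

theorem mul_inv_of_notMem_nullCone {Z : Bicomplex} (hZ : Z ∉ nullCone) : Z * inv Z = 1 := by
  have h : Z.z₁ ^ 2 + Z.z₂ ^ 2 ≠ 0 := hZ
  ext
  · simp only [inv, dag, z₁_mul, z₁_smul, z₂_smul, z₁_mk, z₂_mk, z₁_one]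
    field_simp
    ring
  · simp only [inv, dag, z₂_mul, z₁_smul, z₂_smul, z₁_mk, z₂_mk, z₂_one]
    field_simp
    ring

/-- `f` is bicomplex holomorphic on the whole of `Bicomplex`: at every point the quotient
`(f (Z + H) - f Z) / H` has a limit as `H → 0` off the null cone. -/
def Holomorphic (f : Bicomplex → Bicomplex) : Prop :=
  ∀ Z, ∃ D, Tendsto (fun H => (f (Z + H) - f Z) * inv H) (𝓝[nullConeᶜ] 0) (𝓝 D)

theorem Holomorphic.zero : Holomorphic 0 := fun _ => ⟨0, by simp [tendsto_const_nhds]⟩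

theorem Holomorphic.add {f g : Bicomplex → Bicomplex} (hf : Holomorphic f) (hg : Holomorphic g) :
    Holomorphic (f + g) := fun Z => by
  obtain ⟨D, hD⟩ := hf Z
  obtain ⟨E, hE⟩ := hg Z
  refine ⟨D + E, (hD.add hE).congr fun H => ?_⟩
  simp only [Pi.add_apply]
  ring

theorem Holomorphic.const_smul (A : Bicomplex) {f : Bicomplex → Bicomplex} (hf : Holomorphic f) :
    Holomorphic (A • f) := fun Z => by
  obtain ⟨D, hD⟩ := hf Z
  refine ⟨A * D, (hD.const_mul A).congr fun H => ?_⟩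
  simp only [Pi.smul_apply, smul_eq_mul]
  ring

theorem memLp_const_mul {X : Type*} [MeasurableSpace X] {μ : Measure X} {f : X → Bicomplex}
    (A : Bicomplex) (hf : MemLp f 2 μ) : MemLp (fun x => A * f x) 2 μ :=
  (LinearMap.toContinuousLinearMap (mulLeft A)).comp_memLp' hf

end Bicomplex

open Bicomplex

/-- The Gaussian probability measure `(σ/π)^(1/2) e^(-σ x²) dx` on `ℝ`. -/
def gaussR (σ : ℝ) : Measure ℝ :=
  volume.withDensity fun x => ENNReal.ofReal (√(σ / Real.pi) * Real.exp (-σ * x ^ 2))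

/-- The Gaussian probability measure `(ν/π)² e^(-ν |Z|²) dλ(Z)` on the bicomplex numbers. -/
def gaussBC (ν : ℝ) : Measure Bicomplex :=
  volume.withDensity fun Z => ENNReal.ofReal ((ν / Real.pi) ^ 2 * Real.exp (-ν * ‖Z‖ ^ 2))

/-- The bicomplex module of (classes of) bicomplex-valued functions on the real line that are
square integrable for the Gaussian measure. -/
def L2R (σ : ℝ) : Submodule Bicomplex (ℝ →ₘ[gaussR σ] Bicomplex) where
  carrier := {φ | MemLp φ 2 (gaussR σ)}
  zero_mem' := by
    refine (memLp_congr_ae AEEqFun.coeFn_zero).2 ?_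
    exact MemLp.zero
  add_mem' {φ ψ} hφ hψ := by
    exact (memLp_congr_ae (AEEqFun.coeFn_add φ ψ)).2 (MemLp.add hφ hψ)
  smul_mem' A φ hφ := by
    exact (memLp_congr_ae (AEEqFun.coeFn_smul A φ)).2 (memLp_const_mul A hφ)

/-- The bicomplex Bargmann space: bicomplex holomorphic functions that are square integrable for
the Gaussian measure. -/
def BargmannBC (ν : ℝ) : Submodule Bicomplex (Bicomplex → Bicomplex) where
  carrier := {f | Holomorphic f ∧ MemLp f 2 (gaussBC ν)}
  zero_mem' := ⟨Holomorphic.zero, MemLp.zero⟩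
  add_mem' hf hg := ⟨hf.1.add hg.1, hf.2.add hg.2⟩
  smul_mem' A _ hf := ⟨hf.1.const_smul A, memLp_const_mul A hf.2⟩

/-- The bicomplex-valued inner product `∫ f g* dμ`. -/
def bcInner {X : Type*} [MeasurableSpace X] (μ : Measure X) (f g : X → Bicomplex) : Bicomplex :=
  ∫ x, f x * conj (g x) ∂μ

/-- The integrand `e^(-σ (x - √(ν/(4σ)) Z)²) φ(x)` of the Segal–Bargmann transform. -/
def sbIntegrand (σ ν : ℝ) (φ : ℝ → Bicomplex) (Z : Bicomplex) (x : ℝ) : Bicomplex :=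
  Bicomplex.exp (-(σ • (x • (1 : Bicomplex) - √(ν / (4 * σ)) • Z) ^ 2)) * φ x

/-- The bicomplex Segal–Bargmann transform. -/
def segalBargmann (σ ν : ℝ) (φ : ℝ → Bicomplex) (Z : Bicomplex) : Bicomplex :=
  √(σ / Real.pi) • ∫ x : ℝ, sbIntegrand σ ν φ Z x

/-- The integrand `e^(-ν |Z|² - (ν/4) (Z*)² + √(σν) x Z*) f(Z)` of the inverse transform. -/
def invIntegrand (σ ν : ℝ) (f : Bicomplex → Bicomplex) (x : ℝ) (Z : Bicomplex) : Bicomplex :=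
  Bicomplex.exp (-((ν * ‖Z‖ ^ 2) • (1 : Bicomplex)) - (ν / 4) • (conj Z) ^ 2
    + (√(σ * ν) * x) • conj Z) * f Z

/-- The inverse integral over a set `S` of bicomplex numbers, with its normalization `(ν/π)²`. -/
def invIntegral (σ ν : ℝ) (f : Bicomplex → Bicomplex) (S : Set Bicomplex) (x : ℝ) : Bicomplex :=
  (ν / Real.pi) ^ 2 • ∫ Z in S, invIntegrand σ ν f x Z

end

/-! Everything splits along the idempotents. Product, conjugation `Z*` and exponential act
separately on the coordinates α and β, and a bicomplex holomorphic function is a pair of entire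
functions, one of α and one of β (`Holomorphic.exists_entire`). Since |Z|² = (|α|² + |β|²)/2, under
`gaussBC ν` the variables α/√2 and β/√2 are independent with law `gaussC ν`. The theorem thus
reduces to a scalar Segal–Bargmann transform in each coordinate.

The scalar transform is φ ↦ ⟨k_a, φ⟩, with coherent states k_a(x) = e^(√(σν) x ā − ν ā²/4). Their
Gram matrix e^(ν a b̄/2) is also that of the reproducing kernels K_a of the entire functions of one
coordinate (`inner_kernel_kernel`, `inner_fockKernel_fockKernel`). By uniqueness of Fourier
transforms the k_a span a dense subspace, so k_a ↦ K_a extends to a linear isometry T, and Tφ is the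
transform of φ (`bargmannIso_ae_eq`). For entire F the reproducing property gives ⟨k_a, T*F⟩ = ⟨K_a,
F⟩ = F(a), so every square integrable entire F is reached and the inverse is the restriction of T*
(`bargmann_bargmannAdjoint`).

For h of bounded support, Fubini identifies T*h with the integral of k against h
(`bargmannAdjoint_ae_eq`). As T* is a contraction on all of L², cutting f off to balls yields the
limit in mean. An almost everywhere convergent subsequence yields the pointwise formula, and
combinations of the K_a supply the dense class with absolute convergence. -/

noncomputable section

/-! ### Idempotent coordinates and the splitting of holomorphic functions. -/

namespace Bicomplex

/-- The idempotent coordinates: `coord true = alpha` and `coord false = beta`. -/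
def coord (s : Bool) : Bicomplex →L[ℂ] ℂ :=
  LinearMap.toContinuousLinearMap
    { toFun := fun Z => bif s then Z.alpha else Z.beta
      map_add' := fun Z W => by cases s <;> simp [alpha, beta] <;> ring
      map_smul' := fun c Z => by cases s <;> simp [alpha, beta] <;> ring }

theorem coord_apply (s : Bool) (Z : Bicomplex) :
    coord s Z = bif s then Z.z₁ - Complex.I * Z.z₂ else Z.z₁ + Complex.I * Z.z₂ := rfl

@[simp] theorem coord_one (s : Bool) : coord s 1 = 1 := by cases s <;> simp [coord_apply]

@[simp] theorem coord_mul (s : Bool) (Z W : Bicomplex) :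
    coord s (Z * W) = coord s Z * coord s W := by
  cases s <;> simp [coord_apply] <;> ring_nf <;> simp <;> ring

@[simp] theorem coord_pow (s : Bool) (Z : Bicomplex) (n : ℕ) :
    coord s (Z ^ n) = coord s Z ^ n := by
  induction n with
  | zero => simp
  | succ n ih => rw [pow_succ, coord_mul, ih, pow_succ]

@[simp] theorem coord_real_smul (s : Bool) (r : ℝ) (Z : Bicomplex) :
    coord s (r • Z) = r * coord s Z := by
  rw [← Complex.coe_smul r Z, map_smul, smul_eq_mul]

@[simp] theorem coord_conj (s : Bool) (Z : Bicomplex) :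
    coord s (conj Z) = (starRingEnd ℂ) (coord s Z) := by
  cases s <;> simp [coord_apply, conj]

@[simp] theorem coord_exp (s : Bool) (Z : Bicomplex) :
    coord s (Bicomplex.exp Z) = Complex.exp (coord s Z) := by
  cases s <;> simp [coord_apply, Bicomplex.exp, alpha, beta, ePlus, eMinus] <;>
    ring_nf <;> simp <;> ring

/-- The bicomplex number with given idempotent coordinates. -/
def ofCoord (a : Bool → ℂ) : Bicomplex := a true • ePlus + a false • eMinus

@[simp] theorem coord_ofCoord (s : Bool) (a : Bool → ℂ) : coord s (ofCoord a) = a s := by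
  cases s <;> simp [coord_apply, ofCoord, ePlus, eMinus] <;> ring_nf <;> simp <;> ring

theorem ext_coord {Z W : Bicomplex} (h : ∀ s, coord s Z = coord s W) : Z = W := by
  have h₁ := h true
  have h₂ := h false
  simp only [coord_apply, cond_true, cond_false] at h₁ h₂
  have hz₁ : Z.z₁ = W.z₁ := by linear_combination (h₁ + h₂) / 2
  refine Bicomplex.ext hz₁ (mul_left_cancel₀ Complex.I_ne_zero ?_)
  linear_combination (h₂ - h₁) / 2

@[simp] theorem ofCoord_coord (Z : Bicomplex) : ofCoord (fun s => coord s Z) = Z :=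
  ext_coord fun s => by simp

theorem continuous_ofCoord : Continuous ofCoord := by
  unfold ofCoord
  fun_prop

theorem norm_sq_eq (Z : Bicomplex) : ‖Z‖ ^ 2 = ‖Z.z₁‖ ^ 2 + ‖Z.z₂‖ ^ 2 :=
  WithLp.prod_norm_sq_eq_of_L2 (α := ℂ) (β := ℂ) Z

theorem norm_sq_eq_coord (s : Bool) (Z : Bicomplex) :
    ‖Z‖ ^ 2 = (‖coord s Z‖ ^ 2 + ‖coord (!s) Z‖ ^ 2) / 2 := by
  rw [norm_sq_eq]
  cases s <;>
    simp only [coord_apply, Complex.sq_norm, Complex.normSq_apply, Bool.not_true, Bool.not_false,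
      cond_true, cond_false, Complex.add_re, Complex.add_im, Complex.sub_re, Complex.sub_im,
      Complex.mul_re, Complex.mul_im, Complex.I_re, Complex.I_im] <;> ring

theorem norm_coord_sq_le (s : Bool) (Z : Bicomplex) : ‖coord s Z‖ ^ 2 ≤ 2 * ‖Z‖ ^ 2 := by
  have := norm_sq_eq_coord s Z
  nlinarith [sq_nonneg ‖coord (!s) Z‖]

theorem norm_coord_le (s : Bool) (Z : Bicomplex) : ‖coord s Z‖ ≤ 2 * ‖Z‖ := by
  have := norm_coord_sq_le s Z
  exact le_of_sq_le_sq (by nlinarith [sq_nonneg ‖Z‖]) (by positivity)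

theorem norm_le_coord (Z : Bicomplex) : ‖Z‖ ≤ ‖coord true Z‖ + ‖coord false Z‖ := by
  have h := norm_sq_eq_coord true Z
  simp only [Bool.not_true] at h
  have h₁ := norm_nonneg (coord true Z)
  have h₂ := norm_nonneg (coord false Z)
  refine le_of_sq_le_sq (by nlinarith) (by positivity)

theorem mem_nullCone_iff (s : Bool) (Z : Bicomplex) :
    Z ∈ nullCone ↔ coord s Z * coord (!s) Z = 0 := by
  have : coord s Z * coord (!s) Z = Z.z₁ ^ 2 + Z.z₂ ^ 2 := by
    cases s <;> simp [coord_apply] <;> ring_nf <;> simp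
  rw [this]
  rfl

theorem coord_ne_zero {Z : Bicomplex} (hZ : Z ∉ nullCone) (s : Bool) : coord s Z ≠ 0 :=
  fun h => hZ ((mem_nullCone_iff s Z).2 (by simp [h]))

theorem coord_inv {Z : Bicomplex} (hZ : Z ∉ nullCone) (s : Bool) :
    coord s (inv Z) = (coord s Z)⁻¹ := by
  have h := congrArg (coord s) (mul_inv_of_notMem_nullCone hZ)
  rw [coord_mul, coord_one] at h
  exact eq_inv_of_mul_eq_one_right h

/-- The idempotent whose `s` coordinate is `1`. -/
def idem (s : Bool) : Bicomplex := ofCoord fun t => if t = s then 1 else 0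

@[simp] theorem coord_idem_self (s : Bool) : coord s (idem s) = 1 := by simp [idem]
@[simp] theorem coord_idem_not (s : Bool) : coord s (idem !s) = 0 := by simp [idem]
@[simp] theorem coord_not_idem (s : Bool) : coord (!s) (idem s) = 0 := by simp [idem]

theorem coord_smul_idem_add (s : Bool) (Z : Bicomplex) :
    coord s Z • idem s + coord (!s) Z • idem (!s) = Z := by
  refine ext_coord fun t => ?_
  cases s <;> cases t <;> simp [idem]

theorem tendsto_iff_coord {ι : Type*} {l : Filter ι} {u : ι → Bicomplex} {D : Bicomplex} :
    Tendsto u l (𝓝 D) ↔ ∀ s, Tendsto (fun i => coord s (u i)) l (𝓝 (coord s D)) := by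
  refine ⟨fun h s => ((coord s).continuous.tendsto D).comp h, fun h => ?_⟩
  have := (continuous_ofCoord.tendsto fun s => coord s D).comp (tendsto_pi_nhds.2 h)
  simpa [Function.comp_def] using this

/-- In coordinate `s` the difference quotient is divided by h alone, so near 0 its boundedness gives
|coord s (f (Z + H) − f Z)| ≤ C|h|, whatever the small k is. Invertibility of H requires both h and
k to be nonzero, so this concerns only limits as h → 0, not the value at h = 0. -/
theorem Holomorphic.eventually_tendsto_coord {f : Bicomplex → Bicomplex} (hf : Holomorphic f)
    (s : Bool) (Z : Bicomplex) :
    ∀ᶠ k in 𝓝[≠] (0 : ℂ), Tendsto (fun h : ℂ => coord s (f (Z + (h • idem s + k • idem !s))))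
      (𝓝[≠] 0) (𝓝 (coord s (f Z))) := by
  obtain ⟨D, hD⟩ := hf Z
  have hq := (tendsto_iff_coord.1 hD s).norm.eventually (gt_mem_nhds (lt_add_one _))
  set C := ‖coord s D‖ + 1
  rw [eventually_nhdsWithin_iff] at hq
  have hcont : Tendsto (fun p : ℂ × ℂ => p.2 • idem s + p.1 • idem !s) (𝓝 0 ×ˢ 𝓝 0)
      (𝓝 (0 : Bicomplex)) := by
    have : Continuous fun p : ℂ × ℂ => p.2 • idem s + p.1 • idem !s := by fun_prop
    simpa [nhds_prod_eq] using this.tendsto (0, 0)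
  filter_upwards [eventually_nhdsWithin_of_eventually_nhds (hcont.eventually hq).curry,
    self_mem_nhdsWithin] with k hk hk0
  refine tendsto_iff_norm_sub_tendsto_zero.2 ?_
  have hz : Tendsto (fun h : ℂ => C * ‖h‖) (𝓝[≠] 0) (𝓝 0) := by
    have : Continuous fun h : ℂ => C * ‖h‖ := by fun_prop
    simpa using (this.tendsto 0).mono_left nhdsWithin_le_nhds
  refine squeeze_zero' (Eventually.of_forall fun _ => norm_nonneg _) ?_ hz
  filter_upwards [eventually_nhdsWithin_of_eventually_nhds hk, self_mem_nhdsWithin] with h hh hh0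
  have hk0' : k ≠ 0 := hk0
  have hh0' : h ≠ 0 := hh0
  have hnull : h • idem s + k • idem (!s) ∉ nullCone := by
    rw [mem_nullCone_iff s]
    simp [hk0', hh0']
  have := hh hnull
  simp only [coord_mul, coord_inv hnull, map_add, map_smul, coord_idem_self, coord_idem_not,
    map_sub, smul_eq_mul, mul_one, mul_zero, add_zero, norm_mul, norm_inv] at this
  exact ((mul_inv_lt_iff₀ (norm_pos_iff.2 hh0')).1 this).le

/-- The limit of `coord s ∘ f` towards one nearby point, along the direction `idem s`, can be
computed from two base points. Uniqueness of limits equates the values there, so the function of k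
is locally constant, hence constant on the connected plane. Continuity of f is not available at this
stage. -/
theorem Holomorphic.coord_add_smul_idem_not {f : Bicomplex → Bicomplex} (hf : Holomorphic f)
    (s : Bool) (Z : Bicomplex) (k : ℂ) :
    coord s (f (Z + k • idem !s)) = coord s (f Z) := by
  have hloc : IsLocallyConstant fun k : ℂ => coord s (f (Z + k • idem !s)) := by
    rw [IsLocallyConstant.iff_eventually_eq]
    intro k₀
    have h₀ := hf.eventually_tendsto_coord s (Z + k₀ • idem !s)
    rw [eventually_nhdsWithin_iff, Metric.eventually_nhds_iff] at h₀
    obtain ⟨δ, hδ, h₀⟩ := h₀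
    filter_upwards [Metric.ball_mem_nhds k₀ hδ] with k hk
    rcases eq_or_ne k k₀ with rfl | hne
    · rfl
    -- The parameter k + m of the common target must differ from both k and k₀, since displacements
    -- inside the null cone carry no information.
    have hsmall : ∀ᶠ m in 𝓝[≠] (0 : ℂ), dist (k + m) k₀ < δ ∧ k + m ≠ k₀ := by
      refine eventually_nhdsWithin_of_eventually_nhds ?_
      have hc : Tendsto (fun m : ℂ => k + m) (𝓝 0) (𝓝 k) := by
        simpa using (continuous_const_add k).tendsto 0
      exact (hc.eventually (Metric.isOpen_ball.mem_nhds hk)).and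
        (hc.eventually (isOpen_ne.mem_nhds hne))
    obtain ⟨m, hm, hmδ, hmne⟩ :=
      ((hf.eventually_tendsto_coord s (Z + k • idem !s)).and hsmall).exists
    have h₁ := h₀ (y := k + m - k₀) (by simpa [dist_eq_norm] using hmδ) (sub_ne_zero.2 hmne)
    refine tendsto_nhds_unique (hm.congr fun h => ?_) h₁
    congr 2
    module
  simpa using hloc.apply_eq_of_isPreconnected isPreconnected_univ (Set.mem_univ k)
    (Set.mem_univ 0)

/-- Independence of the other coordinate leaves one complex variable. Its derivative is taken along
the invertible increments h • 1, which may replace h • `idem s` by that same independence. -/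
theorem Holomorphic.exists_entire {f : Bicomplex → Bicomplex} (hf : Holomorphic f) :
    ∃ F : Bool → ℂ → ℂ, (∀ s, Differentiable ℂ (F s)) ∧
      ∀ s Z, coord s (f Z) = F s (coord s Z) := by
  have key : ∀ s Z, coord s (f Z) = coord s (f (coord s Z • idem s)) := fun s Z => by
    conv_lhs => rw [← coord_smul_idem_add s Z]
    exact hf.coord_add_smul_idem_not s _ _
  refine ⟨fun s a => coord s (f (a • idem s)), fun s a => ?_, key⟩
  obtain ⟨D, hD⟩ := hf (a • idem s)
  refine HasDerivAt.differentiableAt (f' := coord s D)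
    (hasDerivAt_iff_tendsto_slope_zero.2 ?_)
  have hnull : ∀ h : ℂ, h ≠ 0 → h • (1 : Bicomplex) ∉ nullCone := fun h hh => by
    rw [mem_nullCone_iff s]
    simpa using hh
  have hlim : Tendsto (fun h : ℂ => h • (1 : Bicomplex)) (𝓝[≠] 0) (𝓝[nullConeᶜ] 0) := by
    refine tendsto_nhdsWithin_iff.2 ⟨?_, ?_⟩
    · have : Continuous fun h : ℂ => h • (1 : Bicomplex) := by fun_prop
      simpa using (this.tendsto 0).mono_left nhdsWithin_le_nhds
    · filter_upwards [self_mem_nhdsWithin] with h hh using hnull h hh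
  refine ((tendsto_iff_coord.1 hD s).comp hlim).congr' ?_
  filter_upwards [self_mem_nhdsWithin] with h hh
  simp only [Function.comp_apply, coord_mul, coord_inv (hnull h hh), map_sub, map_smul, coord_one,
    key s (a • idem s + h • 1), map_add, coord_idem_self, smul_eq_mul, mul_one]
  ring

theorem Holomorphic.of_entire {f : Bicomplex → Bicomplex} {F : Bool → ℂ → ℂ}
    (hF : ∀ s, Differentiable ℂ (F s)) (hfF : ∀ s Z, coord s (f Z) = F s (coord s Z)) :
    Holomorphic f := fun Z => by
  refine ⟨ofCoord fun s => deriv (F s) (coord s Z), tendsto_iff_coord.2 fun s => ?_⟩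
  have hd := hasDerivAt_iff_tendsto_slope_zero.1 ((hF s) (coord s Z)).hasDerivAt
  have hlim : Tendsto (coord s) (𝓝[nullConeᶜ] 0) (𝓝[≠] 0) := by
    refine tendsto_nhdsWithin_iff.2 ⟨?_, ?_⟩
    · simpa using ((coord s).continuous.tendsto 0).mono_left nhdsWithin_le_nhds
    · filter_upwards [self_mem_nhdsWithin] with H hH using coord_ne_zero hH s
  rw [coord_ofCoord]
  refine (hd.comp hlim).congr' ?_
  filter_upwards [self_mem_nhdsWithin] with H hH
  simp only [Function.comp_apply, coord_mul, coord_inv hH, map_sub, hfF, map_add, smul_eq_mul]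
  ring

/-- Quotients by invertible H do not control f along the null cone directly; continuity comes from
the entire components. -/
theorem Holomorphic.continuous {f : Bicomplex → Bicomplex} (hf : Holomorphic f) :
    Continuous f := by
  obtain ⟨F, hF, hfF⟩ := hf.exists_entire
  have : f = fun Z => ofCoord fun s => F s (coord s Z) :=
    funext fun Z => ext_coord fun s => by simp [hfF]
  rw [this]
  exact continuous_ofCoord.comp
    (continuous_pi fun s => (hF s).continuous.comp (coord s).continuous)

end Bicomplex

/-! ### Measures with density, Gaussian measures and the reproducing property on the plane. -/

section WithDensity

variable {X Y : Type*} [MeasurableSpace X] [MeasurableSpace Y] {μ : Measure X} {m : Measure Y}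

theorem integral_withDensity_ofReal {E : Type*} [NormedAddCommGroup E] [NormedSpace ℝ E]
    {w : X → ℝ} (hw : Measurable w) (hw0 : ∀ x, 0 ≤ w x) (g : X → E) :
    ∫ x, g x ∂(μ.withDensity fun x => ENNReal.ofReal (w x)) = ∫ x, w x • g x ∂μ := by
  rw [integral_withDensity_eq_integral_toReal_smul hw.ennreal_ofReal (by simp)]
  simp [ENNReal.toReal_ofReal (hw0 _)]

theorem integrable_withDensity_ofReal {E : Type*} [NormedAddCommGroup E] [NormedSpace ℝ E]
    {w : X → ℝ} (hw : Measurable w) (hw0 : ∀ x, 0 ≤ w x) {g : X → E} :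
    Integrable g (μ.withDensity fun x => ENNReal.ofReal (w x)) ↔
      Integrable (fun x => w x • g x) μ := by
  rw [integrable_withDensity_iff_integrable_smul' hw.ennreal_ofReal (by simp)]
  simp [ENNReal.toReal_ofReal (hw0 _)]

theorem isProbabilityMeasure_withDensity_ofReal {w : X → ℝ} (hw : Integrable w μ)
    (hw0 : ∀ x, 0 ≤ w x) (h1 : ∫ x, w x ∂μ = 1) :
    IsProbabilityMeasure (μ.withDensity fun x => ENNReal.ofReal (w x)) := by
  refine ⟨?_⟩
  rw [withDensity_apply _ MeasurableSet.univ, Measure.restrict_univ,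
    ← ofReal_integral_eq_lintegral_ofReal hw (Eventually.of_forall hw0), h1, ENNReal.ofReal_one]

theorem MeasureTheory.MeasurePreserving.withDensity_comp {f : X → Y}
    (hf : MeasurePreserving f μ m) {ρ : Y → ENNReal} (hρ : Measurable ρ) :
    MeasurePreserving f (μ.withDensity fun x => ρ (f x)) (m.withDensity ρ) := by
  refine ⟨hf.measurable, Measure.ext fun s hs => ?_⟩
  rw [Measure.map_apply hf.measurable hs, withDensity_apply _ hs,
    withDensity_apply _ (hf.measurable hs), hf.setLIntegral_comp_preimage hs hρ]

end WithDensity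

/-- The Gaussian probability measure `(ν/π) e^(-ν |z|²) dz` on the complex plane. -/
def gaussC (ν : ℝ) : Measure ℂ :=
  volume.withDensity fun z => ENNReal.ofReal (ν / Real.pi * Real.exp (-ν * ‖z‖ ^ 2))

theorem isProbabilityMeasure_gaussC {ν : ℝ} (hν : 0 < ν) : IsProbabilityMeasure (gaussC ν) := by
  have hint : ∫ z : ℂ, Real.exp (-ν * ‖z‖ ^ 2) = Real.pi / ν := by
    simpa using GaussianFourier.integral_rexp_neg_mul_sq_norm (V := ℂ) hν
  have hi : Integrable fun z : ℂ => Real.exp (-ν * ‖z‖ ^ 2) :=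
    Integrable.of_integral_ne_zero (by rw [hint]; positivity)
  refine isProbabilityMeasure_withDensity_ofReal (hi.const_mul _) (fun z => by positivity) ?_
  rw [integral_const_mul, hint]
  field_simp

theorem isProbabilityMeasure_gaussR {σ : ℝ} (hσ : 0 < σ) : IsProbabilityMeasure (gaussR σ) := by
  refine isProbabilityMeasure_withDensity_ofReal ((integrable_exp_neg_mul_sq hσ).const_mul _)
    (fun z => by positivity) ?_
  rw [integral_const_mul, integral_gaussian, ← Real.sqrt_mul (by positivity)]
  field_simp
  simp

theorem measurePreserving_exp_mul_gaussC (ν θ : ℝ) :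
    MeasurePreserving (fun z : ℂ => Complex.exp (θ * Complex.I) * z) (gaussC ν) (gaussC ν) := by
  have h := (LinearIsometryEquiv.measurePreserving (rotation (Circle.exp θ))).withDensity_comp
    (ρ := fun z => ENNReal.ofReal (ν / Real.pi * Real.exp (-ν * ‖z‖ ^ 2))) (by fun_prop)
  have hrot : ⇑(rotation (Circle.exp θ)) = fun z : ℂ => Complex.exp (θ * Complex.I) * z :=
    funext fun z => by simp [rotation_apply, Circle.coe_exp]
  simp only [LinearIsometryEquiv.norm_map] at h
  rwa [hrot] at h

/-- The mean value property for the Gaussian measure. -/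
theorem integral_gaussC_of_differentiable {ν : ℝ} (hν : 0 < ν) {F : ℂ → ℂ}
    (hF : Differentiable ℂ F) (hi : Integrable F (gaussC ν)) : ∫ z, F z ∂(gaussC ν) = F 0 := by
  have := isProbabilityMeasure_gaussC hν
  have hmp := measurePreserving_exp_mul_gaussC ν
  have hFm : AEStronglyMeasurable F (gaussC ν) := hi.1
  -- F(e^(iθ) z) is integrated over θ and z in both orders: rotation invariance makes the z-integral
  -- independent of θ, and the mean value property on circles makes the θ-integral equal to 2π F(0).
  have hprod : Integrable (fun p : ℝ × ℂ => F (Complex.exp (p.1 * Complex.I) * p.2))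
      ((volume.restrict (Set.Ioc 0 (2 * Real.pi))).prod (gaussC ν)) := by
    have hc : Continuous fun p : ℝ × ℂ => F (Complex.exp (p.1 * Complex.I) * p.2) :=
      hF.continuous.comp (by fun_prop)
    refine (integrable_prod_iff hc.aestronglyMeasurable).2 ⟨?_, ?_⟩
    · exact Eventually.of_forall fun θ => ((hmp θ).integrable_comp hFm).2 hi
    · have : ∀ θ : ℝ, ∫ z, ‖F (Complex.exp (θ * Complex.I) * z)‖ ∂(gaussC ν)
          = ∫ z, ‖F z‖ ∂(gaussC ν) := fun θ => by
        have h := integral_map (hmp θ).aemeasurable (f := fun z => ‖F z‖)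
          (by rw [(hmp θ).map_eq]; exact hFm.norm)
        rw [(hmp θ).map_eq] at h
        exact h.symm
      simp only [this]
      exact integrable_const _
  have hswap := integral_integral_swap
    (f := fun (θ : ℝ) (z : ℂ) => F (Complex.exp (θ * Complex.I) * z)) hprod
  have hleft : ∀ θ : ℝ, ∫ z, F (Complex.exp (θ * Complex.I) * z) ∂(gaussC ν)
      = ∫ z, F z ∂(gaussC ν) := fun θ => by
    have h := integral_map (hmp θ).aemeasurable (f := F) (by rw [(hmp θ).map_eq]; exact hFm)
    rw [(hmp θ).map_eq] at h
    exact h.symm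
  have hright : ∀ z : ℂ, ∫ θ in Set.Ioc 0 (2 * Real.pi), F (Complex.exp (θ * Complex.I) * z)
      = (2 * Real.pi) • F 0 := fun z => by
    have hd : Differentiable ℂ fun w => F (w * z) := hF.comp (differentiable_id.mul_const z)
    have h := DiffContOnCl.circleAverage (c := 0) (R := 1) (hd.diffContOnCl)
    rw [Real.circleAverage, inv_smul_eq_iff₀ (by positivity),
      intervalIntegral.integral_of_le (by positivity)] at h
    simpa [circleMap] using h
  simp only [hleft, hright, integral_const] at hswap
  simp only [probReal_univ, one_smul, measureReal_restrict_apply_univ, Real.volume_real_Ioc,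
    sub_zero] at hswap
  rw [max_eq_left (by positivity)] at hswap
  exact smul_right_injective ℂ (by positivity : (2 * Real.pi) ≠ 0) hswap

/-- The reproducing property of the kernel `e^(ν a z̄)` on the Gaussian plane. -/
theorem integral_gaussC_mul_exp {ν : ℝ} (hν : 0 < ν) {F : ℂ → ℂ} (hF : Differentiable ℂ F)
    (a : ℂ) (hi : Integrable (fun z => F z * Complex.exp (ν * a * (starRingEnd ℂ) z)) (gaussC ν)) :
    ∫ z, F z * Complex.exp (ν * a * (starRingEnd ℂ) z) ∂(gaussC ν) = F a := by
  set w : ℂ → ℝ := fun z => ν / Real.pi * Real.exp (-ν * ‖z‖ ^ 2) with hw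
  have hwm : Measurable w := by fun_prop
  have hw0 : ∀ z, 0 ≤ w z := fun z => by positivity
  -- After translation by a, the exponent −ν|z + a|² + νa·conj(z + a) becomes −ν|z|² − νāz. The
  -- factor beside the Gaussian is then entire in z, with value F(a) at 0.
  have hshift : ∀ z, w (z + a) • (F (z + a) * Complex.exp (ν * a * (starRingEnd ℂ) (z + a)))
      = w z • (F (z + a) * Complex.exp (-ν * (starRingEnd ℂ) a * z)) := fun z => by
    have hexp : Complex.exp (-ν * (‖z + a‖ : ℂ) ^ 2) *
        Complex.exp (ν * a * (starRingEnd ℂ) (z + a)) =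
        Complex.exp (-ν * (‖z‖ : ℂ) ^ 2) * Complex.exp (-ν * (starRingEnd ℂ) a * z) := by
      rw [← Complex.exp_add, ← Complex.exp_add, ← Complex.mul_conj', ← Complex.mul_conj', map_add]
      congr 1
      ring
    simp only [hw, Complex.real_smul]
    push_cast
    linear_combination ((ν : ℂ) / Real.pi * F (z + a)) * hexp
  rw [gaussC, integrable_withDensity_ofReal hwm hw0] at hi
  have hi' := hi.comp_add_right a
  simp only [hshift] at hi'
  have key := integral_gaussC_of_differentiable hν
    (F := fun z => F (z + a) * Complex.exp (-ν * (starRingEnd ℂ) a * z)) (by fun_prop)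
    ((integrable_withDensity_ofReal hwm hw0).2 hi')
  rw [gaussC, integral_withDensity_ofReal hwm hw0] at key ⊢
  rw [← integral_add_right_eq_self _ a]
  simp only [hshift]
  rw [key]
  simp

/-! ### The bicomplex Gaussian measure in idempotent coordinates. -/

namespace Bicomplex

/-- The normalized idempotent coordinates as a linear isometry onto `ℂ²`. -/
def coordIsometry (s : Bool) : Bicomplex ≃ₗᵢ[ℝ] WithLp 2 (ℂ × ℂ) :=
  LinearIsometry.toLinearIsometryEquiv
    { toFun := fun Z => WithLp.toLp 2
        (coord s Z / (√2 : ℝ), coord (!s) Z / (√2 : ℝ))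
      map_add' := fun Z W => by
        rw [← WithLp.toLp_add]
        simp [add_div]
      map_smul' := fun r Z => by
        rw [RingHom.id_apply, ← WithLp.toLp_smul]
        simp [mul_div_assoc]
      norm_map' := fun Z => by
        rw [← sq_eq_sq₀ (norm_nonneg _) (norm_nonneg _), norm_sq_eq_coord s Z]
        refine (WithLp.prod_norm_sq_eq_of_L2 _).trans ?_
        simp [div_pow, add_div] }
    (by rfl)

theorem volume_preserving_coord_prod (s : Bool) :
    MeasurePreserving (fun Z : Bicomplex => (coord s Z / (√2 : ℝ), coord (!s) Z / (√2 : ℝ)))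
      volume (volume.prod volume) := by
  have h₁ : MeasurePreserving (coordIsometry s) := (coordIsometry s).measurePreserving
  exact (WithLp.volume_preserving_ofLp ℂ ℂ).comp h₁

/-- Division by √2 makes ‖Z‖² the sum of the two squared moduli, so the coordinate map preserves
Lebesgue measure and the Gaussian density factors. -/
theorem measurePreserving_coord_prod {ν : ℝ} (hν : 0 < ν) (s : Bool) :
    MeasurePreserving (fun Z => (coord s Z / (√2 : ℝ), coord (!s) Z / (√2 : ℝ)))
      (gaussBC ν) ((gaussC ν).prod (gaussC ν)) := by
  have hm : Measurable fun z : ℂ => ENNReal.ofReal (ν / Real.pi * Real.exp (-ν * ‖z‖ ^ 2)) := by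
    fun_prop
  have h := (volume_preserving_coord_prod s).withDensity_comp (ρ := fun z : ℂ × ℂ =>
    ENNReal.ofReal (ν / Real.pi * Real.exp (-ν * ‖z.1‖ ^ 2)) *
      ENNReal.ofReal (ν / Real.pi * Real.exp (-ν * ‖z.2‖ ^ 2))) (by fun_prop)
  have hρ : ∀ Z : Bicomplex,
      ENNReal.ofReal (ν / Real.pi * Real.exp (-ν * ‖coord s Z / (√2 : ℝ)‖ ^ 2)) *
      ENNReal.ofReal (ν / Real.pi * Real.exp (-ν * ‖coord (!s) Z / (√2 : ℝ)‖ ^ 2)) =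
      ENNReal.ofReal ((ν / Real.pi) ^ 2 * Real.exp (-ν * ‖Z‖ ^ 2)) := fun Z => by
    rw [← ENNReal.ofReal_mul (by positivity), mul_mul_mul_comm, ← Real.exp_add, ← sq,
      norm_sq_eq_coord s Z]
    congr 3
    simp [div_pow]
    ring
  simp only [hρ] at h
  rw [gaussC, prod_withDensity hm hm]
  exact h

theorem measurePreserving_coord {ν : ℝ} (hν : 0 < ν) (s : Bool) :
    MeasurePreserving (fun Z => coord s Z / (√2 : ℝ)) (gaussBC ν) (gaussC ν) := by
  have := isProbabilityMeasure_gaussC hν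
  exact measurePreserving_fst.comp (measurePreserving_coord_prod hν s)

theorem isProbabilityMeasure_gaussBC {ν : ℝ} (hν : 0 < ν) : IsProbabilityMeasure (gaussBC ν) := by
  have := isProbabilityMeasure_gaussC hν
  have h := measurePreserving_coord hν true
  rwa [← h.map_eq, Measure.isProbabilityMeasure_map_iff h.aemeasurable] at this

instance : (volume : Measure Bicomplex).IsAddHaarMeasure :=
  inferInstanceAs (volume : Measure (WithLp 2 (ℂ × ℂ))).IsAddHaarMeasure

theorem integrable_rexp_neg_mul_sq_norm {b : ℝ} (hb : 0 < b) :
    Integrable fun Z : Bicomplex => Real.exp (-b * ‖Z‖ ^ 2) := by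
  have := GaussianFourier.integral_rexp_neg_mul_sq_norm (V := Bicomplex) hb
  refine Integrable.of_integral_ne_zero ?_
  erw [this]
  positivity

end Bicomplex

/-! ### Uniqueness of Fourier transforms of integrable functions. -/

section FourierUniqueness

variable {μ : Measure ℝ}

theorem MeasureTheory.Integrable.exp_mul_I_mul {φ : ℝ → ℂ} (hφ : Integrable φ μ) (t : ℝ) :
    Integrable (fun x : ℝ => Complex.exp (t * x * Complex.I) * φ x) μ := by
  refine hφ.bdd_mul (c := 1) (by fun_prop) (Eventually.of_forall fun x => ?_)
  rw [← Complex.ofReal_mul, Complex.norm_exp_ofReal_mul_I]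

/-- The positive and negative parts are densities of two finite measures with the same
characteristic function, hence equal almost everywhere. As at most one of them is nonzero at each
point, both vanish. -/
theorem ae_eq_zero_of_real_fourier_eq_zero {u : ℝ → ℝ} (hu : Integrable u μ)
    (h : ∀ t : ℝ, ∫ x, Complex.exp (t * x * Complex.I) * u x ∂μ = 0) : u =ᵐ[μ] 0 := by
  obtain ⟨v, hvm, huv⟩ := hu.1.aemeasurable
  have hv : Integrable v μ := hu.congr huv
  have hv0 : ∀ t : ℝ, ∫ x, Complex.exp (t * x * Complex.I) * v x ∂μ = 0 := fun t => by
    rw [← h t]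
    exact integral_congr_ae (huv.mono fun x hx => by simp [hx])
  have hfin : ∀ w : ℝ → ℝ, Integrable w μ →
      IsFiniteMeasure (μ.withDensity fun x => ENNReal.ofReal (w x)) := fun w hw =>
    isFiniteMeasure_withDensity_ofReal hw.2
  have := hfin v hv
  have := hfin (fun x => -v x) hv.neg
  have hchar : ∀ w : ℝ → ℝ, Measurable w → ∀ t : ℝ,
      charFun (μ.withDensity fun x => ENNReal.ofReal (w x)) t
        = ∫ x, Complex.exp (t * x * Complex.I) * (max (w x) 0 : ℝ) ∂μ := fun w hw t => by
    rw [charFun_apply_real, integral_withDensity_eq_integral_toReal_smul hw.ennreal_ofReal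
      (by simp)]
    refine integral_congr_ae (Eventually.of_forall fun x => ?_)
    simp only [ENNReal.toReal_ofReal', Complex.real_smul]
    ring
  have heq : (μ.withDensity fun x => ENNReal.ofReal (v x))
      = μ.withDensity fun x => ENNReal.ofReal (-v x) := by
    refine Measure.ext_of_charFun (funext fun t => ?_)
    have hp : Integrable (fun x => ((max (v x) 0 : ℝ) : ℂ)) μ := hv.pos_part.ofReal
    have hn : Integrable (fun x => ((max (-v x) 0 : ℝ) : ℂ)) μ := hv.neg_part.ofReal
    rw [hchar v hvm t, hchar (fun x => -v x) hvm.neg t, ← sub_eq_zero,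
      ← integral_sub (hp.exp_mul_I_mul t) (hn.exp_mul_I_mul t), ← hv0 t]
    refine integral_congr_ae (Eventually.of_forall fun x => ?_)
    simp only [← mul_sub, ← Complex.ofReal_sub]
    congr 2
    rcases le_total 0 (v x) with hx | hx <;> simp [hx]
  have hae : (fun x => ENNReal.ofReal (v x)) =ᵐ[μ] fun x => ENNReal.ofReal (-v x) :=
    (withDensity_eq_iff hvm.ennreal_ofReal.aemeasurable
    hvm.neg.ennreal_ofReal.aemeasurable
      (by simpa using (lintegral_ofReal_le_lintegral_enorm v).trans_lt hv.2 |>.ne)).1 heq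
  filter_upwards [huv, hae] with x hx hx'
  rw [hx]
  simp only [Pi.zero_apply]
  rcases le_total 0 (v x) with h0 | h0
  · rw [ENNReal.ofReal_of_nonpos (neg_nonpos.2 h0), ENNReal.ofReal_eq_zero] at hx'
    exact le_antisymm hx' h0
  · rw [ENNReal.ofReal_of_nonpos h0, eq_comm, ENNReal.ofReal_eq_zero] at hx'
    linarith

/-- Conjugating the hypothesis at −t shows that the conjugate of φ has zero transform too, which
reduces the claim to the real and imaginary parts. -/
theorem ae_eq_zero_of_fourier_eq_zero {φ : ℝ → ℂ} (hφ : Integrable φ μ)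
    (h : ∀ t : ℝ, ∫ x, Complex.exp (t * x * Complex.I) * φ x ∂μ = 0) : φ =ᵐ[μ] 0 := by
  have hconj : ∀ t : ℝ, ∫ x, Complex.exp (t * x * Complex.I) * (starRingEnd ℂ) (φ x) ∂μ = 0 :=
    fun t => by
      have := congrArg (starRingEnd ℂ) (h (-t))
      rw [← integral_conj, map_zero] at this
      rw [← this]
      refine integral_congr_ae (Eventually.of_forall fun x => ?_)
      simp [← Complex.exp_conj]
  have hφ' : Integrable (fun x => (starRingEnd ℂ) (φ x)) μ :=
    (Complex.conjLIE.toContinuousLinearEquiv.toContinuousLinearMap.integrable_comp hφ)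
  have hre := ae_eq_zero_of_real_fourier_eq_zero (u := fun x => (φ x).re) hφ.re fun t => by
    have := integral_add (hφ.exp_mul_I_mul t) (hφ'.exp_mul_I_mul t)
    rw [h, hconj, add_zero] at this
    have h2 : ∫ x, 2 * (Complex.exp (t * x * Complex.I) * ((φ x).re : ℂ)) ∂μ = 0 := by
      rw [← this]
      refine integral_congr_ae (Eventually.of_forall fun x => ?_)
      simp only [Complex.re_eq_add_conj]
      ring
    simpa [integral_const_mul] using h2
  have him := ae_eq_zero_of_real_fourier_eq_zero (u := fun x => (φ x).im) hφ.im fun t => by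
    have := integral_sub (hφ.exp_mul_I_mul t) (hφ'.exp_mul_I_mul t)
    rw [h, hconj, sub_zero] at this
    have h2 : ∫ x, (2 * Complex.I) * (Complex.exp (t * x * Complex.I) * ((φ x).im : ℂ)) ∂μ
        = 0 := by
      rw [← this]
      refine integral_congr_ae (Eventually.of_forall fun x => ?_)
      simp only [Complex.im_eq_sub_conj]
      field_simp
    simpa [integral_const_mul] using h2
  filter_upwards [hre, him] with x h₁ h₂ using Complex.ext h₁ h₂

end FourierUniqueness

/-! ### Exponentials of linear functions on the Gaussian line. -/

section GaussianLine

variable {σ : ℝ}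

theorem integral_gaussR {E : Type*} [NormedAddCommGroup E] [NormedSpace ℝ E] (g : ℝ → E) :
    ∫ x, g x ∂(gaussR σ) = ∫ x, (√(σ / Real.pi) * Real.exp (-σ * x ^ 2)) • g x :=
  integral_withDensity_ofReal (by fun_prop) (fun x => by positivity) g

theorem integrable_gaussR {E : Type*} [NormedAddCommGroup E] [NormedSpace ℝ E] {g : ℝ → E} :
    Integrable g (gaussR σ) ↔
      Integrable fun x => (√(σ / Real.pi) * Real.exp (-σ * x ^ 2)) • g x :=
  integrable_withDensity_ofReal (by fun_prop) (fun x => by positivity)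

theorem volume_absolutelyContinuous_gaussR (hσ : 0 < σ) : volume ≪ gaussR σ := by
  refine withDensity_absolutelyContinuous' (by fun_prop) (Eventually.of_forall fun x => ?_)
  have : 0 < √(σ / Real.pi) * Real.exp (-σ * x ^ 2) := by positivity
  exact (ENNReal.ofReal_pos.2 this).ne'

theorem integrable_cexp_linear_gaussR (hσ : 0 < σ) (c d : ℂ) :
    Integrable (fun x : ℝ => Complex.exp (c * x + d)) (gaussR σ) := by
  rw [integrable_gaussR]
  have h := (integrable_cexp_quadratic' (b := (-σ : ℂ)) (by simpa using hσ) c d).const_mul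
    (√(σ / Real.pi) : ℂ)
  refine h.congr (Eventually.of_forall fun x => ?_)
  simp only [Complex.real_smul]
  push_cast
  rw [mul_assoc, ← Complex.exp_add, add_assoc]

theorem integral_cexp_linear_gaussR (hσ : 0 < σ) (c d : ℂ) :
    ∫ x : ℝ, Complex.exp (c * x + d) ∂(gaussR σ) = Complex.exp (c ^ 2 / (4 * σ) + d) := by
  have h := integral_cexp_quadratic (b := (-σ : ℂ)) (by simpa using hσ) c d
  have hsq : (√(σ / Real.pi) : ℂ) * (Real.pi / - -(σ : ℂ)) ^ (1 / 2 : ℂ) = 1 := by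
    rw [neg_neg, ← Complex.ofReal_div, show (1 / 2 : ℂ) = ((1 / 2 : ℝ) : ℂ) by norm_num,
      ← Complex.ofReal_cpow (by positivity), ← Real.sqrt_eq_rpow, ← Complex.ofReal_mul,
      ← Real.sqrt_mul (by positivity)]
    field_simp
    simp
  rw [integral_gaussR]
  calc _ = ∫ x : ℝ, (√(σ / Real.pi) : ℂ) * Complex.exp (-σ * x ^ 2 + c * x + d) := by
        refine integral_congr_ae (Eventually.of_forall fun x => ?_)
        simp only [Complex.real_smul]
        push_cast
        rw [mul_assoc, ← Complex.exp_add, add_assoc]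
    _ = _ := by
        rw [integral_const_mul, h, ← mul_assoc, hsq, one_mul]
        congr 1
        have : (σ : ℂ) ≠ 0 := by exact_mod_cast hσ.ne'
        field_simp
        ring

theorem memLp_cexp_linear_gaussR (hσ : 0 < σ) (c d : ℂ) :
    MemLp (fun x : ℝ => Complex.exp (c * x + d)) 2 (gaussR σ) := by
  refine (memLp_two_iff_integrable_sq_norm (by fun_prop)).2 ?_
  refine (integrable_cexp_linear_gaussR hσ (2 * c) (2 * d)).norm.congr
    (Eventually.of_forall fun x => ?_)
  simp only [Complex.norm_exp, ← Real.exp_nat_mul]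
  congr 1
  rw [show 2 * c * (x : ℂ) + 2 * d = (2 : ℝ) * (c * x + d) by push_cast; ring, Complex.re_ofReal_mul]
  simp

end GaussianLine

/-! ### The reproducing property for the bicomplex Gaussian measure. -/

namespace Bicomplex

variable {ν : ℝ}

theorem integral_gaussBC {E : Type*} [NormedAddCommGroup E] [NormedSpace ℝ E]
    (g : Bicomplex → E) :
    ∫ Z, g Z ∂(gaussBC ν) = ∫ Z, ((ν / Real.pi) ^ 2 * Real.exp (-ν * ‖Z‖ ^ 2)) • g Z :=
  integral_withDensity_ofReal (by fun_prop) (fun x => by positivity) g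

theorem integrable_gaussBC {E : Type*} [NormedAddCommGroup E] [NormedSpace ℝ E]
    {g : Bicomplex → E} :
    Integrable g (gaussBC ν) ↔
      Integrable fun Z => ((ν / Real.pi) ^ 2 * Real.exp (-ν * ‖Z‖ ^ 2)) • g Z :=
  integrable_withDensity_ofReal (by fun_prop) (fun x => by positivity)

/-- Half of the quadratic decay absorbs the linear term, by completing the square. -/
theorem integrable_rexp_neg_mul_sq_norm_add {b : ℝ} (hb : 0 < b) (C : ℝ) :
    Integrable fun Z : Bicomplex => Real.exp (-b * ‖Z‖ ^ 2 + C * ‖Z‖) := by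
  refine ((integrable_rexp_neg_mul_sq_norm (half_pos hb)).const_mul
    (Real.exp (C ^ 2 / (2 * b)))).mono' (by fun_prop) (Eventually.of_forall fun Z => ?_)
  rw [Real.norm_of_nonneg (by positivity), ← Real.exp_add, Real.exp_le_exp]
  have : C ^ 2 / (2 * b) + -(b / 2) * ‖Z‖ ^ 2 - (-b * ‖Z‖ ^ 2 + C * ‖Z‖)
      = (C - b * ‖Z‖) ^ 2 / (2 * b) := by
    field_simp
    ring
  have h2 : 0 ≤ (C - b * ‖Z‖) ^ 2 / (2 * b) := by positivity
  linarith

theorem memLp_cexp_coord (hν : 0 < ν) (s : Bool) (c : ℂ) :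
    MemLp (fun Z => Complex.exp (c * coord s Z)) 2 (gaussBC ν) := by
  refine (memLp_two_iff_integrable_sq_norm (by fun_prop)).2 ?_
  rw [integrable_gaussBC]
  refine ((integrable_rexp_neg_mul_sq_norm_add hν (4 * ‖c‖)).const_mul
    ((ν / Real.pi) ^ 2)).mono' (by fun_prop) (Eventually.of_forall fun Z => ?_)
  rw [Real.norm_of_nonneg (by positivity), smul_eq_mul, Real.exp_add, ← mul_assoc]
  gcongr
  rw [Complex.norm_exp, ← Real.exp_nat_mul, Real.exp_le_exp]
  have h1 := (Complex.re_le_norm (c * coord s Z)).trans_eq (norm_mul _ _)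
  have h2 := mul_le_mul_of_nonneg_left (norm_coord_le s Z) (norm_nonneg c)
  push_cast
  linarith

/-- The reproducing property in an idempotent coordinate. -/
theorem integral_gaussBC_mul_exp (hν : 0 < ν) (s : Bool) {F : ℂ → ℂ} (hF : Differentiable ℂ F)
    (hL : MemLp (fun Z => F (coord s Z)) 2 (gaussBC ν)) (a : ℂ) :
    ∫ Z, F (coord s Z) * Complex.exp (ν / 2 * a * (starRingEnd ℂ) (coord s Z)) ∂(gaussBC ν)
      = F a := by
  have h2 : ((√2 : ℝ) : ℂ) ≠ 0 := by simp
  have h22 : ((√2 : ℝ) : ℂ) * ((√2 : ℝ) : ℂ) = 2 := by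
    rw [← Complex.ofReal_mul, Real.mul_self_sqrt (by norm_num)]
    simp
  have hmp := measurePreserving_coord hν s
  -- The variable with law `gaussC ν` is the coordinate divided by √2. Rescaling a in the same way
  -- turns the parameter ν of the planar kernel into ν/2.
  set G : ℂ → ℂ := fun z => F ((√2 : ℝ) * z) *
    Complex.exp (ν * (a / (√2 : ℝ)) * (starRingEnd ℂ) z) with hG
  have hGc : Continuous G := by
    have := hF.continuous
    fun_prop
  have hcomp : ∀ Z, G (coord s Z / (√2 : ℝ))
      = F (coord s Z) * Complex.exp (ν / 2 * a * (starRingEnd ℂ) (coord s Z)) := fun Z => by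
    simp only [hG, mul_div_cancel₀ _ h2, map_div₀, Complex.conj_ofReal]
    congr 2
    rw [← h22]
    field_simp
  have hK := memLp_cexp_coord hν s (ν / 2 * (starRingEnd ℂ) a)
  have hint : Integrable (fun Z => G (coord s Z / (√2 : ℝ))) (gaussBC ν) := by
    simp only [hcomp]
    refine hL.integrable_mul (p := 2) (q := 2) ?_
    refine hK.star.ae_eq (Eventually.of_forall fun Z => ?_)
    simp [← Complex.exp_conj, Complex.conj_ofNat]
  have key := integral_gaussC_mul_exp hν (F := fun z => F ((√2 : ℝ) * z)) (by fun_prop)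
    (a / (√2 : ℝ)) ((hmp.integrable_comp hGc.aestronglyMeasurable).1 hint)
  have hmap := integral_map hmp.aemeasurable (f := G) hGc.aestronglyMeasurable
  rw [hmp.map_eq] at hmap
  simp only [hcomp] at hmap
  rw [← hmap]
  refine key.trans ?_
  simp only [mul_div_cancel₀ _ h2]

end Bicomplex

/-! ### Isometries determined by Gram matrices. -/

section LinearIsometryOfKernels

variable {𝕜 ι E F : Type*} [RCLike 𝕜] [NormedAddCommGroup E] [InnerProductSpace 𝕜 E]
  [NormedAddCommGroup F] [InnerProductSpace 𝕜 F] [CompleteSpace F]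

theorem norm_linearCombination_eq_of_inner_eq {F : Type*} [NormedAddCommGroup F]
    [InnerProductSpace 𝕜 F] {k : ι → E} {K : ι → F}
    (h : ∀ a b, inner 𝕜 (K a) (K b) = inner 𝕜 (k a) (k b)) (c : ι →₀ 𝕜) :
    ‖Finsupp.linearCombination 𝕜 K c‖ = ‖Finsupp.linearCombination 𝕜 k c‖ := by
  have : inner 𝕜 (Finsupp.linearCombination 𝕜 K c) (Finsupp.linearCombination 𝕜 K c)
      = inner 𝕜 (Finsupp.linearCombination 𝕜 k c) (Finsupp.linearCombination 𝕜 k c) := by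
    simp only [Finsupp.linearCombination_apply, Finsupp.sum, sum_inner, inner_sum,
      inner_smul_left, inner_smul_right, h]
  rw [← sq_eq_sq₀ (norm_nonneg _) (norm_nonneg _), ← inner_self_eq_norm_sq (𝕜 := 𝕜), this,
    inner_self_eq_norm_sq]

/-- Two families with the same Gram matrix, the first with dense span, are related by a linear
isometry. -/
theorem exists_linearIsometry_of_inner_eq {k : ι → E} {K : ι → F}
    (h : ∀ a b, inner 𝕜 (K a) (K b) = inner 𝕜 (k a) (k b))
    (hk : (Submodule.span 𝕜 (Set.range k)).topologicalClosure = ⊤) :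
    ∃ T : E →ₗᵢ[𝕜] F, ∀ a, T (k a) = K a := by
  have hd : DenseRange (Finsupp.linearCombination 𝕜 k) := by
    rw [DenseRange, ← LinearMap.coe_range, Finsupp.range_linearCombination]
    exact Submodule.dense_iff_topologicalClosure_eq_top.2 hk
  have hn := norm_linearCombination_eq_of_inner_eq h
  -- Equality of norms makes the assignment well defined even if the `k a` are linearly dependent,
  -- and bounded, so it extends from the dense span.
  set T := (Finsupp.linearCombination 𝕜 K).extendOfNorm (Finsupp.linearCombination 𝕜 k)
  have hT : ∀ c, T (Finsupp.linearCombination 𝕜 k c) = Finsupp.linearCombination 𝕜 K c :=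
    LinearMap.extendOfNorm_eq hd ⟨1, fun c => by rw [one_mul, hn]⟩
  refine ⟨⟨T.toLinearMap, fun x => ?_⟩, fun a => ?_⟩
  · refine hd.induction (P := fun x => ‖T x‖ = ‖x‖) ?_
      (isClosed_eq (by fun_prop) (by fun_prop)) x
    rintro _ ⟨c, rfl⟩
    rw [hT, hn]
  · simpa using hT (Finsupp.single a 1)

end LinearIsometryOfKernels

theorem inner_toLp {X : Type*} [MeasurableSpace X] {μ : Measure X} {f g : X → ℂ}
    (hf : MemLp f 2 μ) (hg : MemLp g 2 μ) :
    inner ℂ (hf.toLp f) (hg.toLp g) = ∫ x, g x * (starRingEnd ℂ) (f x) ∂μ := by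
  rw [L2.inner_def]
  refine integral_congr_ae ?_
  filter_upwards [hf.coeFn_toLp, hg.coeFn_toLp] with x h₁ h₂
  rw [h₁, h₂, RCLike.inner_apply]

/-! ### The scalar transform, its isometry and its adjoint. -/

namespace SegalBargmann

open Bicomplex

variable {σ ν : ℝ}

/-- The coherent state `e^(√(σν) x ā - ν ā² / 4)` on the line. -/
def kernelFun (σ ν : ℝ) (a : ℂ) (x : ℝ) : ℂ :=
  Complex.exp (√(σ * ν) * (starRingEnd ℂ) a * x + -(ν / 4 * (starRingEnd ℂ) a ^ 2))

theorem continuous_kernelFun (σ ν : ℝ) :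
    Continuous fun p : ℂ × ℝ => kernelFun σ ν p.1 p.2 := by
  unfold kernelFun
  fun_prop

theorem conj_kernelFun (σ ν : ℝ) (a : ℂ) (x : ℝ) :
    (starRingEnd ℂ) (kernelFun σ ν a x)
      = Complex.exp (√(σ * ν) * a * x + -(ν / 4 * a ^ 2)) := by
  simp [kernelFun, ← Complex.exp_conj, Complex.conj_ofNat]

theorem memLp_kernelFun (hσ : 0 < σ) (ν : ℝ) (a : ℂ) :
    MemLp (kernelFun σ ν a) 2 (gaussR σ) :=
  memLp_cexp_linear_gaussR hσ _ _

/-- The coherent states as elements of `L²`. -/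
def kernel (hσ : 0 < σ) (ν : ℝ) (a : ℂ) : Lp ℂ 2 (gaussR σ) := (memLp_kernelFun hσ ν a).toLp _

/-- The Gaussian integral contributes ν(b̄ + a)²/4; the normalizing terms −ν ā²/4 of the coherent
states cancel its squares and leave the cross term. -/
theorem inner_kernel_kernel (hσ : 0 < σ) (hν : 0 < ν) (a b : ℂ) :
    inner ℂ (kernel hσ ν a) (kernel hσ ν b)
      = Complex.exp (ν / 2 * (starRingEnd ℂ) b * a) := by
  have hσ' : (σ : ℂ) ≠ 0 := by exact_mod_cast hσ.ne'
  have hsq : ((√(σ * ν) : ℝ) : ℂ) ^ 2 = σ * ν := by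
    rw [← Complex.ofReal_pow, Real.sq_sqrt (by positivity), Complex.ofReal_mul]
  rw [kernel, kernel, inner_toLp]
  simp only [conj_kernelFun]
  have : ∀ x : ℝ, kernelFun σ ν b x * Complex.exp (√(σ * ν) * a * x + -(ν / 4 * a ^ 2))
      = Complex.exp (√(σ * ν) * ((starRingEnd ℂ) b + a) * x +
        -(ν / 4 * ((starRingEnd ℂ) b ^ 2 + a ^ 2))) := fun x => by
    rw [kernelFun, ← Complex.exp_add]
    congr 1
    ring
  simp only [this]
  rw [integral_cexp_linear_gaussR hσ, mul_pow, hsq]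
  congr 1
  field_simp
  ring

theorem norm_kernel (hσ : 0 < σ) (hν : 0 < ν) (a : ℂ) :
    ‖kernel hσ ν a‖ = Real.exp (ν / 4 * ‖a‖ ^ 2) := by
  rw [← sq_eq_sq₀ (norm_nonneg _) (by positivity), ← inner_self_eq_norm_sq (𝕜 := ℂ),
    inner_kernel_kernel hσ hν, mul_assoc, mul_comm _ a, Complex.mul_conj', ← Real.exp_nat_mul,
    show (ν / 2 * (‖a‖ : ℂ) ^ 2) = ((ν / 2 * ‖a‖ ^ 2 : ℝ) : ℂ) by push_cast; ring,
    ← Complex.ofReal_exp]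
  simp only [RCLike.re_to_complex, Complex.ofReal_re]
  congr 1
  push_cast
  ring

/-- The Segal–Bargmann transform of a complex-valued function. -/
def bargmann (hσ : 0 < σ) (ν : ℝ) (φ : Lp ℂ 2 (gaussR σ)) (a : ℂ) : ℂ :=
  inner ℂ (kernel hσ ν a) φ

theorem bargmann_eq_integral (hσ : 0 < σ) (ν : ℝ) (φ : Lp ℂ 2 (gaussR σ)) (a : ℂ) :
    bargmann hσ ν φ a
      = ∫ x, φ x * Complex.exp (√(σ * ν) * a * x + -(ν / 4 * a ^ 2)) ∂(gaussR σ) := by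
  have h := inner_toLp (memLp_kernelFun hσ ν a) (Lp.memLp φ)
  simp only [conj_kernelFun, Lp.toLp_coeFn] at h
  exact h

/-- If φ is orthogonal to all coherent states, its transform vanishes everywhere. At the imaginary
points a = it/√(σν) this transform is, up to a nonzero factor, the Fourier transform of φ for
`gaussR σ`. -/
theorem span_kernel_dense (hσ : 0 < σ) (hν : 0 < ν) :
    (Submodule.span ℂ (Set.range (kernel hσ ν))).topologicalClosure = ⊤ := by
  have := isProbabilityMeasure_gaussR hσ
  rw [Submodule.topologicalClosure_eq_top_iff, Submodule.eq_bot_iff]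
  intro φ hφ
  have h0 : ∀ a, bargmann hσ ν φ a = 0 := fun a =>
    (Submodule.mem_orthogonal _ _).1 hφ _ (Submodule.subset_span ⟨a, rfl⟩)
  have hs : (√(σ * ν) : ℂ) ≠ 0 := by
    simp [Real.sqrt_ne_zero', hσ, hν]
  refine (Lp.eq_zero_iff_ae_eq_zero).2 (ae_eq_zero_of_fourier_eq_zero
    ((Lp.memLp φ).integrable (by norm_num)) fun t => ?_)
  have h := h0 (t * Complex.I / (√(σ * ν) : ℝ))
  rw [bargmann_eq_integral] at h
  set d : ℂ := -(ν / 4 * (t * Complex.I / (√(σ * ν) : ℝ)) ^ 2) with hd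
  have : ∀ x : ℝ, φ x * Complex.exp (√(σ * ν) * (t * Complex.I / (√(σ * ν) : ℝ)) * x + d)
      = Complex.exp d * (Complex.exp (t * x * Complex.I) * φ x) := fun x => by
    rw [Complex.exp_add, mul_div_cancel₀ _ hs, show (t : ℂ) * Complex.I * x = t * x * Complex.I by
      ring]
    ring
  simp only [this, integral_const_mul] at h
  exact (mul_eq_zero.1 h).resolve_left (Complex.exp_ne_zero _)

theorem kernel_induction (hσ : 0 < σ) (hν : 0 < ν) {p : Lp ℂ 2 (gaussR σ) → Prop}
    (kernel : ∀ a, p (kernel hσ ν a)) (zero : p 0) (add : ∀ φ ψ, p φ → p ψ → p (φ + ψ))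
    (smul : ∀ (c : ℂ) φ, p φ → p (c • φ))
    (closed : ∀ (u : ℕ → Lp ℂ 2 (gaussR σ)) φ, (∀ n, p (u n)) → Tendsto u atTop (𝓝 φ) → p φ)
    (φ : Lp ℂ 2 (gaussR σ)) : p φ := by
  have hd := (Submodule.dense_iff_topologicalClosure_eq_top.2 (span_kernel_dense hσ hν)) φ
  obtain ⟨u, hu, hlim⟩ := mem_closure_iff_seq_limit.1 hd
  refine closed u φ (fun n => ?_) hlim
  refine Submodule.span_induction (p := fun φ _ => p φ) ?_ zero (fun φ ψ _ _ => add φ ψ)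
    (fun c φ _ => smul c φ) (hu n)
  rintro _ ⟨a, rfl⟩
  exact kernel a

theorem bargmann_add (hσ : 0 < σ) (ν : ℝ) (φ ψ : Lp ℂ 2 (gaussR σ)) :
    bargmann hσ ν (φ + ψ) = bargmann hσ ν φ + bargmann hσ ν ψ :=
  funext fun _ => inner_add_right _ _ _

theorem bargmann_smul (hσ : 0 < σ) (ν : ℝ) (c : ℂ) (φ : Lp ℂ 2 (gaussR σ)) :
    bargmann hσ ν (c • φ) = c • bargmann hσ ν φ :=
  funext fun _ => inner_smul_right _ _ _

theorem bargmann_zero (hσ : 0 < σ) (ν : ℝ) : bargmann hσ ν 0 = 0 :=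
  funext fun _ => inner_zero_right _

theorem bargmann_kernel (hσ : 0 < σ) (hν : 0 < ν) (b : ℂ) :
    bargmann hσ ν (kernel hσ ν b) = fun a => Complex.exp (ν / 2 * (starRingEnd ℂ) b * a) :=
  funext fun a => inner_kernel_kernel hσ hν a b

theorem tendsto_bargmann (hσ : 0 < σ) (ν : ℝ) {u : ℕ → Lp ℂ 2 (gaussR σ)} {φ : Lp ℂ 2 (gaussR σ)}
    (h : Tendsto u atTop (𝓝 φ)) (a : ℂ) :
    Tendsto (fun n => bargmann hσ ν (u n) a) atTop (𝓝 (bargmann hσ ν φ a)) :=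
  tendsto_const_nhds.inner h

/-- Coherent states have exponentials as transforms. By Cauchy–Schwarz and `norm_kernel`, which is
bounded on discs, L² convergence gives locally uniform convergence of the transforms, and holomorphy
survives. -/
theorem differentiable_bargmann (hσ : 0 < σ) (hν : 0 < ν) (φ : Lp ℂ 2 (gaussR σ)) :
    Differentiable ℂ (bargmann hσ ν φ) := by
  refine kernel_induction hσ hν (p := fun φ => Differentiable ℂ (bargmann hσ ν φ))
    (fun b => ?_) ?_ (fun φ ψ h₁ h₂ => ?_) (fun c φ h => ?_)
    (fun u φ hu hlim => ?_) φ
  · rw [bargmann_kernel hσ hν]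
    fun_prop
  · rw [bargmann_zero]
    exact differentiable_const 0
  · rw [bargmann_add]
    exact h₁.add h₂
  · rw [bargmann_smul]
    exact h.const_smul c
  · rw [← differentiableOn_univ]
    refine TendstoLocallyUniformlyOn.differentiableOn (F := fun n => bargmann hσ ν (u n))
      (φ := atTop) ?_ (Eventually.of_forall fun n => (hu n).differentiableOn) isOpen_univ
    rw [Metric.tendstoLocallyUniformlyOn_iff]
    intro ε hε x _
    refine ⟨Metric.ball x 1, mem_nhdsWithin_of_mem_nhds (Metric.ball_mem_nhds x one_pos), ?_⟩
    set M := Real.exp (ν / 4 * (‖x‖ + 1) ^ 2) with hM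
    have hM0 : 0 < M := Real.exp_pos _
    filter_upwards [Metric.tendsto_nhds.1 hlim (ε / M) (by positivity)] with n hn y hy
    have hy' : ‖kernel hσ ν y‖ ≤ M := by
      rw [norm_kernel hσ hν, hM]
      have : ‖y‖ ≤ ‖x‖ + 1 := by
        have h1 := norm_le_norm_add_norm_sub' y x
        rw [Metric.mem_ball, dist_eq_norm] at hy
        linarith
      gcongr
    calc dist (bargmann hσ ν φ y) (bargmann hσ ν (u n) y)
        = ‖inner ℂ (kernel hσ ν y) (φ - u n)‖ := by
          rw [dist_eq_norm, bargmann, bargmann, inner_sub_right]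
      _ ≤ ‖kernel hσ ν y‖ * ‖φ - u n‖ := norm_inner_le_norm _ _
      _ ≤ M * ‖φ - u n‖ := by gcongr
      _ < M * (ε / M) := by
          gcongr
          rwa [dist_comm, dist_eq_norm] at hn
      _ = ε := by field_simp

/-- The reproducing kernel of the Bargmann space in an idempotent coordinate. -/
def fockKernel (hν : 0 < ν) (s : Bool) (b : ℂ) : Lp ℂ 2 (gaussBC ν) :=
  (memLp_cexp_coord hν s (ν / 2 * (starRingEnd ℂ) b)).toLp _

theorem inner_fockKernel_toLp (hν : 0 < ν) (s : Bool) {F : ℂ → ℂ} (hF : Differentiable ℂ F)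
    (hL : MemLp (fun Z => F (coord s Z)) 2 (gaussBC ν)) (a : ℂ) :
    inner ℂ (fockKernel hν s a) (hL.toLp _) = F a := by
  rw [fockKernel, inner_toLp, ← integral_gaussBC_mul_exp hν s hF hL a]
  simp [← Complex.exp_conj, Complex.conj_ofNat]

theorem inner_fockKernel_fockKernel (hν : 0 < ν) (s : Bool) (a b : ℂ) :
    inner ℂ (fockKernel hν s a) (fockKernel hν s b)
      = Complex.exp (ν / 2 * (starRingEnd ℂ) b * a) := by
  have hF : Differentiable ℂ fun z => Complex.exp (ν / 2 * (starRingEnd ℂ) b * z) := by fun_prop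
  exact inner_fockKernel_toLp hν s hF (memLp_cexp_coord hν s (ν / 2 * (starRingEnd ℂ) b)) a

theorem exists_bargmannIso (hσ : 0 < σ) (hν : 0 < ν) (s : Bool) :
    ∃ T : Lp ℂ 2 (gaussR σ) →ₗᵢ[ℂ] Lp ℂ 2 (gaussBC ν),
      ∀ a, T (kernel hσ ν a) = fockKernel hν s a :=
  exists_linearIsometry_of_inner_eq
    (fun a b => by rw [inner_fockKernel_fockKernel, inner_kernel_kernel hσ hν])
    (span_kernel_dense hσ hν)

/-- The Segal–Bargmann transform in an idempotent coordinate, as a linear isometry. -/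
def bargmannIso (hσ : 0 < σ) (hν : 0 < ν) (s : Bool) :
    Lp ℂ 2 (gaussR σ) →ₗᵢ[ℂ] Lp ℂ 2 (gaussBC ν) :=
  (exists_bargmannIso hσ hν s).choose

theorem bargmannIso_kernel (hσ : 0 < σ) (hν : 0 < ν) (s : Bool) (a : ℂ) :
    bargmannIso hσ hν s (kernel hσ ν a) = fockKernel hν s a :=
  (exists_bargmannIso hσ hν s).choose_spec a

/-- This identifies the isometry obtained by abstract extension with the concrete transform. In the
limit step a subsequence of the images converges almost everywhere, while the transforms converge at
every point. -/
theorem bargmannIso_ae_eq (hσ : 0 < σ) (hν : 0 < ν) (s : Bool) (φ : Lp ℂ 2 (gaussR σ)) :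
    bargmannIso hσ hν s φ =ᵐ[gaussBC ν] fun Z => bargmann hσ ν φ (coord s Z) := by
  refine kernel_induction hσ hν (p := fun φ => bargmannIso hσ hν s φ =ᵐ[gaussBC ν]
      fun Z => bargmann hσ ν φ (coord s Z)) (fun b => ?_) ?_ (fun φ ψ h₁ h₂ => ?_) (fun c φ h => ?_)
    (fun u φ hu hlim => ?_) φ
  · rw [bargmann_kernel hσ hν, bargmannIso_kernel]
    exact MemLp.coeFn_toLp _
  · rw [bargmann_zero, map_zero]
    exact Lp.coeFn_zero _ _ _
  · rw [bargmann_add, map_add]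
    filter_upwards [Lp.coeFn_add (bargmannIso hσ hν s φ) (bargmannIso hσ hν s ψ), h₁, h₂] with
      Z hZ hZ₁ hZ₂
    rw [hZ, Pi.add_apply, hZ₁, hZ₂, Pi.add_apply]
  · rw [bargmann_smul, map_smul]
    filter_upwards [Lp.coeFn_smul c (bargmannIso hσ hν s φ), h] with Z hZ hZ₁
    rw [hZ, Pi.smul_apply, hZ₁, Pi.smul_apply]
  · have hT : Tendsto (fun n => bargmannIso hσ hν s (u n)) atTop (𝓝 (bargmannIso hσ hν s φ)) :=
      ((bargmannIso hσ hν s).continuous.tendsto φ).comp hlim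
    obtain ⟨ns, hns, hae⟩ := (tendstoInMeasure_of_tendsto_Lp hT).exists_seq_tendsto_ae
    filter_upwards [hae, ae_all_iff.2 hu] with Z hZ huZ
    simp only [huZ] at hZ
    exact tendsto_nhds_unique hZ
      ((tendsto_bargmann hσ ν hlim (coord s Z)).comp hns.tendsto_atTop)

theorem memLp_bargmann (hσ : 0 < σ) (hν : 0 < ν) (s : Bool) (φ : Lp ℂ 2 (gaussR σ)) :
    MemLp (fun Z => bargmann hσ ν φ (coord s Z)) 2 (gaussBC ν) :=
  (memLp_congr_ae (bargmannIso_ae_eq hσ hν s φ)).1 (Lp.memLp _)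

theorem toLp_bargmann (hσ : 0 < σ) (hν : 0 < ν) (s : Bool) (φ : Lp ℂ 2 (gaussR σ)) :
    (memLp_bargmann hσ hν s φ).toLp _ = bargmannIso hσ hν s φ :=
  Lp.ext ((MemLp.coeFn_toLp _).trans (bargmannIso_ae_eq hσ hν s φ).symm)

theorem bargmann_injective (hσ : 0 < σ) (hν : 0 < ν) : Function.Injective (bargmann hσ ν) := by
  intro φ ψ h
  refine (bargmannIso hσ hν true).injective (Lp.ext ?_)
  refine (bargmannIso_ae_eq hσ hν true φ).trans ?_
  rw [h]
  exact (bargmannIso_ae_eq hσ hν true ψ).symm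

/-- The adjoint of the Segal–Bargmann transform in an idempotent coordinate. -/
def bargmannAdjoint (hσ : 0 < σ) (hν : 0 < ν) (s : Bool) :
    Lp ℂ 2 (gaussBC ν) →L[ℂ] Lp ℂ 2 (gaussR σ) :=
  ContinuousLinearMap.adjoint (bargmannIso hσ hν s).toContinuousLinearMap

theorem norm_bargmannAdjoint_le (hσ : 0 < σ) (hν : 0 < ν) (s : Bool) (h : Lp ℂ 2 (gaussBC ν)) :
    ‖bargmannAdjoint hσ hν s h‖ ≤ ‖h‖ := by
  refine ((bargmannAdjoint hσ hν s).le_opNorm h).trans (mul_le_of_le_one_left (norm_nonneg _) ?_)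
  rw [bargmannAdjoint, LinearIsometryEquiv.norm_map]
  exact (bargmannIso hσ hν s).norm_toContinuousLinearMap_le

/-- This is surjectivity: moving the adjoint across the inner product turns the coherent state into
the reproducing kernel, which evaluates F at a. -/
theorem bargmann_bargmannAdjoint (hσ : 0 < σ) (hν : 0 < ν) (s : Bool) {F : ℂ → ℂ}
    (hF : Differentiable ℂ F) (hL : MemLp (fun Z => F (coord s Z)) 2 (gaussBC ν)) :
    bargmann hσ ν (bargmannAdjoint hσ hν s (hL.toLp _)) = F := by
  funext a
  rw [bargmann, bargmannAdjoint, ContinuousLinearMap.adjoint_inner_right]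
  refine Eq.trans ?_ (inner_fockKernel_toLp hν s hF hL a)
  rw [← bargmannIso_kernel hσ]
  rfl

theorem bargmannAdjoint_bargmann (hσ : 0 < σ) (hν : 0 < ν) (s : Bool)
    (φ : Lp ℂ 2 (gaussR σ)) :
    bargmannAdjoint hσ hν s ((memLp_bargmann hσ hν s φ).toLp _) = φ :=
  bargmann_injective hσ hν (bargmann_bargmannAdjoint hσ hν s (differentiable_bargmann hσ hν φ) _)

theorem norm_kernelFun_le_exp (hν : 0 < ν) (a : ℂ) (x : ℝ) :
    ‖kernelFun σ ν a x‖ ≤ Real.exp (√(σ * ν) * ‖a‖ * |x| + ν / 4 * ‖a‖ ^ 2) := by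
  rw [kernelFun, Complex.norm_exp, Real.exp_le_exp, Complex.add_re]
  refine add_le_add ((Complex.re_le_norm _).trans_eq ?_) ((Complex.re_le_norm _).trans_eq ?_)
  · simp only [norm_mul, RCLike.norm_conj, Complex.norm_real, Real.norm_eq_abs,
      abs_of_nonneg (Real.sqrt_nonneg _)]
  · simp only [norm_neg, norm_mul, norm_pow, norm_div, RCLike.norm_conj, Complex.norm_real,
      Real.norm_eq_abs, abs_of_pos hν, Complex.norm_ofNat]

/-- Bounding e^(c|x|) by e^(cx) + e^(−cx) leaves exponentials of linear functions, which are
integrable for `gaussR σ`. The bound is uniform in a on a disc. -/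
theorem norm_kernelFun_le (hν : 0 < ν) {a : ℂ} {r : ℝ} (ha : ‖a‖ ≤ r) (x : ℝ) :
    ‖kernelFun σ ν a x‖ ≤ Real.exp (ν / 4 * r ^ 2) *
      (Real.exp (√(σ * ν) * r * x) + Real.exp (-(√(σ * ν) * r * x))) := by
  have h1 : ‖kernelFun σ ν a x‖ ≤ Real.exp (√(σ * ν) * r * |x| + ν / 4 * r ^ 2) :=
    (norm_kernelFun_le_exp hν a x).trans (by gcongr)
  refine h1.trans ?_
  rw [Real.exp_add, mul_comm]
  gcongr
  rcases abs_cases x with ⟨hx, _⟩ | ⟨hx, _⟩ <;> rw [hx]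
  · exact le_add_of_nonneg_right (Real.exp_pos _).le
  · rw [mul_neg]
    exact le_add_of_nonneg_left (Real.exp_pos _).le

theorem integrable_kernelFun_prod (hσ : 0 < σ) (hν : 0 < ν) (s : Bool) {h : Bicomplex → ℂ}
    (hh : Integrable h (gaussBC ν)) {R : ℝ} (hR : ∀ Z, R ≤ ‖Z‖ → h Z = 0) :
    Integrable (Function.uncurry fun (x : ℝ) Z => kernelFun σ ν (coord s Z) x * h Z)
      ((gaussR σ).prod (gaussBC ν)) := by
  have := isProbabilityMeasure_gaussR hσ
  have := isProbabilityMeasure_gaussBC hν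
  -- By `norm_coord_le`, the coordinates of Z have modulus at most 2R when ‖Z‖ < R.
  set r := 2 * R with hr
  have hexp : ∀ c : ℝ, Integrable (fun x : ℝ => Real.exp (c * x)) (gaussR σ) := fun c => by
    refine (integrable_cexp_linear_gaussR hσ c 0).norm.congr (Eventually.of_forall fun x => ?_)
    simp [Complex.norm_exp]
  have hbound : Integrable (fun x : ℝ => Real.exp (ν / 4 * r ^ 2) *
      (Real.exp (√(σ * ν) * r * x) + Real.exp (-(√(σ * ν) * r * x)))) (gaussR σ) := by
    refine ((hexp _).add ((hexp (-(√(σ * ν) * r))).congr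
      (Eventually.of_forall fun x => ?_))).const_mul _
    simp [neg_mul]
  refine (hbound.mul_prod hh.norm).mono' ?_ (Eventually.of_forall fun p => ?_)
  · have hk : Continuous fun p : ℝ × Bicomplex => kernelFun σ ν (coord s p.2) p.1 := by
      have hc : Continuous fun p : ℝ × Bicomplex => (coord s p.2, p.1) := by fun_prop
      exact (continuous_kernelFun σ ν).comp hc
    have h₁ : AEStronglyMeasurable (fun p : ℝ × Bicomplex => kernelFun σ ν (coord s p.2) p.1)
        ((gaussR σ).prod (gaussBC ν)) := hk.aestronglyMeasurable
    have h₂ : AEStronglyMeasurable (fun p : ℝ × Bicomplex => h p.2)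
        ((gaussR σ).prod (gaussBC ν)) := hh.1.comp_snd
    exact h₁.mul h₂
  · simp only [Function.uncurry, norm_mul]
    rcases le_or_gt R ‖p.2‖ with hp | hp
    · simp [hR _ hp]
    · gcongr
      refine norm_kernelFun_le hν ?_ p.1
      have := norm_coord_le s p.2
      linarith

/-- The integral formula for the adjoint, for functions of bounded support. -/
theorem bargmannAdjoint_ae_eq (hσ : 0 < σ) (hν : 0 < ν) (s : Bool) {h : Bicomplex → ℂ}
    (hh : MemLp h 2 (gaussBC ν)) {R : ℝ} (hR : ∀ Z, R ≤ ‖Z‖ → h Z = 0) :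
    bargmannAdjoint hσ hν s (hh.toLp h) =ᵐ[gaussR σ]
      fun x => ∫ Z, kernelFun σ ν (coord s Z) x * h Z ∂(gaussBC ν) := by
  have := isProbabilityMeasure_gaussR hσ
  have := isProbabilityMeasure_gaussBC hν
  have hprod := integrable_kernelFun_prod hσ hν s (hh.integrable (by norm_num)) hR
  -- Both sides are compared after integration over a set S. On the left this is ⟨1_S, T*h⟩ = ⟨T
  -- 1_S, h⟩, where T 1_S is the transform of an indicator; Fubini brings the right side to the same
  -- form.
  refine Integrable.ae_eq_of_forall_setIntegral_eq _ _
    ((Lp.memLp _).integrable (by norm_num)) hprod.integral_prod_left fun S hS hS' => ?_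
  have hrestrict : Integrable (Function.uncurry fun (x : ℝ) Z => kernelFun σ ν (coord s Z) x * h Z)
      (((gaussR σ).restrict S).prod (gaussBC ν)) := by
    have := hprod.integrableOn (s := S ×ˢ Set.univ)
    rwa [IntegrableOn, ← Measure.prod_restrict, Measure.restrict_univ] at this
  rw [integral_integral_swap hrestrict,
    ← L2.inner_indicatorConstLp_one (𝕜 := ℂ) hS hS'.ne, bargmannAdjoint,
    ContinuousLinearMap.adjoint_inner_right, L2.inner_def]
  refine integral_congr_ae ?_
  filter_upwards [bargmannIso_ae_eq hσ hν s (indicatorConstLp 2 hS hS'.ne (1 : ℂ)),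
    hh.coeFn_toLp] with Z hZ hZ'
  rw [integral_mul_const, RCLike.inner_apply, hZ', LinearIsometry.coe_toContinuousLinearMap, hZ,
    bargmann, inner_conj_symm, L2.inner_indicatorConstLp_one, mul_comm]
  congr 1
  exact integral_congr_ae (ae_restrict_of_ae (MemLp.coeFn_toLp _))

end SegalBargmann

/-! ### Integrability and L² norms through the coordinates. -/

namespace Bicomplex

variable {X : Type*} [MeasurableSpace X] {μ : Measure X}

theorem memLp_coord (s : Bool) {f : X → Bicomplex} (hf : MemLp f 2 μ) :
    MemLp (fun x => coord s (f x)) 2 μ :=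
  (coord s).comp_memLp' hf

theorem memLp_of_coord {f : X → Bicomplex} (hf : ∀ s, MemLp (fun x => coord s (f x)) 2 μ) :
    MemLp f 2 μ := by
  have h : ∀ s, MemLp (fun x => coord s (f x) • idem s) 2 μ := fun s =>
    (ContinuousLinearMap.toSpanSingleton ℂ (idem s)).comp_memLp' (hf s)
  refine ((h true).add (h false)).ae_eq (Eventually.of_forall fun x => ?_)
  exact coord_smul_idem_add true (f x)

theorem integrable_of_coord {f : X → Bicomplex} (hf : ∀ s, Integrable (fun x => coord s (f x)) μ) :
    Integrable f μ := by
  have h : ∀ s, Integrable (fun x => coord s (f x) • idem s) μ := fun s =>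
    (hf s).smul_const _
  refine ((h true).add (h false)).congr (Eventually.of_forall fun x => ?_)
  exact coord_smul_idem_add true (f x)

theorem coord_integral (s : Bool) {f : X → Bicomplex} (hf : Integrable f μ) :
    coord s (∫ x, f x ∂μ) = ∫ x, coord s (f x) ∂μ :=
  ((coord s).integral_comp_comm hf).symm

theorem eLpNorm_le_coord {f : X → Bicomplex} (hf : AEStronglyMeasurable f μ) :
    eLpNorm f 2 μ ≤ eLpNorm (fun x => coord true (f x)) 2 μ +
      eLpNorm (fun x => coord false (f x)) 2 μ := by
  have hm : ∀ s, AEStronglyMeasurable (fun x => ‖coord s (f x)‖) μ := fun s =>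
    ((coord s).continuous.comp_aestronglyMeasurable hf).norm
  refine (eLpNorm_mono_real fun x => norm_le_coord (f x)).trans ?_
  refine (eLpNorm_add_le (hm true) (hm false) (by norm_num)).trans_eq ?_
  simp only [eLpNorm_norm]

/-- The exact identity serves for preservation of the norm; the cruder `eLpNorm_le_coord` suffices
for limits and approximation. -/
theorem eLpNorm_sq_eq_coord {f : X → Bicomplex} (hf : AEStronglyMeasurable f μ) :
    eLpNorm f 2 μ ^ 2 = (eLpNorm (fun x => coord true (f x)) 2 μ ^ 2 +
      eLpNorm (fun x => coord false (f x)) 2 μ ^ 2) / 2 := by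
  have hsq : ∀ {E : Type} [NormedAddCommGroup E] (g : X → E),
      eLpNorm g 2 μ ^ 2 = ∫⁻ x, ‖g x‖ₑ ^ 2 ∂μ := fun g => by
    simpa using eLpNorm_nnreal_pow_eq_lintegral (μ := μ) (f := g) (p := 2) two_ne_zero
  have hm : AEMeasurable (fun x => ‖coord true (f x)‖ₑ ^ 2) μ :=
    ((coord true).continuous.comp_aestronglyMeasurable hf).enorm.pow_const 2
  rw [hsq, hsq, hsq, ← lintegral_add_left' hm, ENNReal.div_eq_inv_mul,
    ← lintegral_const_mul' _ _ (by simp)]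
  refine lintegral_congr fun x => ?_
  rw [← ENNReal.div_eq_inv_mul, ← ofReal_norm, ← ofReal_norm, ← ofReal_norm,
    ← ENNReal.ofReal_pow (norm_nonneg _), ← ENNReal.ofReal_pow (norm_nonneg _),
    ← ENNReal.ofReal_pow (norm_nonneg _), ← ENNReal.ofReal_add (by positivity) (by positivity),
    norm_sq_eq_coord true, ENNReal.ofReal_div_of_pos two_pos]
  simp

end Bicomplex

/-- Dominated convergence with majorant ‖h‖²: every point eventually lies in the ball. -/
theorem MeasureTheory.MemLp.tendsto_eLpNorm_sub_indicator_ball {X E : Type*}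
    [NormedAddCommGroup X] [MeasurableSpace X] [OpensMeasurableSpace X] [NormedAddCommGroup E]
    {μ : Measure X} {h : X → E} (hh : MemLp h 2 μ) :
    Tendsto (fun R : ℝ => eLpNorm (h - (Metric.ball 0 R).indicator h) 2 μ) atTop (𝓝 0) := by
  have hdiff : ∀ R : ℝ, h - (Metric.ball 0 R).indicator h = (Metric.ball 0 R)ᶜ.indicator h :=
    fun R => by rw [Set.indicator_compl]
  simp only [hdiff, eLpNorm_eq_lintegral_rpow_enorm_toReal two_ne_zero ENNReal.ofNat_ne_top,
    ENNReal.toReal_ofNat]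
  have hlim : Tendsto (fun R : ℝ => ∫⁻ x, ‖(Metric.ball (0 : X) R)ᶜ.indicator h x‖ₑ ^ (2 : ℝ) ∂μ)
      atTop (𝓝 (∫⁻ _, 0 ∂μ)) := by
    refine tendsto_lintegral_filter_of_dominated_convergence' (fun x => ‖h x‖ₑ ^ (2 : ℝ)) ?_ ?_ ?_ ?_
    · exact Eventually.of_forall fun R =>
        ((hh.1.indicator Metric.isOpen_ball.measurableSet.compl).enorm.pow_const _)
    · exact Eventually.of_forall fun R => Eventually.of_forall fun x => by
        gcongr
        exact enorm_indicator_le_enorm_self _ _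
    · have := lintegral_rpow_enorm_lt_top_of_eLpNorm_lt_top two_ne_zero ENNReal.ofNat_ne_top hh.2
      simpa using this.ne
    · refine Eventually.of_forall fun x => ?_
      refine tendsto_const_nhds.congr' ?_
      filter_upwards [eventually_gt_atTop ‖x‖] with R hR
      simp [hR]
  have := ((ENNReal.continuous_rpow_const (y := 1 / 2)).tendsto _).comp hlim
  simpa [Function.comp_def] using this

/-! ### The bicomplex transform, its inverse and the integral formula. -/

namespace SegalBargmann

open Bicomplex

variable {σ ν : ℝ}

/-- The idempotent coordinates of a bicomplex-valued square integrable function. -/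
def coordLp (s : Bool) (φ : L2R σ) : Lp ℂ 2 (gaussR σ) :=
  MemLp.toLp (fun x => coord s (φ.1 x)) (memLp_coord s φ.2)

theorem coordLp_ae_eq (s : Bool) (φ : L2R σ) :
    coordLp s φ =ᵐ[gaussR σ] fun x => coord s (φ.1 x) := MemLp.coeFn_toLp _

theorem coordLp_add (s : Bool) (φ ψ : L2R σ) :
    coordLp s (φ + ψ) = coordLp s φ + coordLp s ψ := by
  refine Lp.ext ?_
  filter_upwards [coordLp_ae_eq s (φ + ψ), coordLp_ae_eq s φ, coordLp_ae_eq s ψ,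
    Lp.coeFn_add (coordLp s φ) (coordLp s ψ), AEEqFun.coeFn_add φ.1 ψ.1] with x h₁ h₂ h₃ h₄ h₅
  have h₅' : (φ + ψ).1 x = φ.1 x + ψ.1 x := h₅
  rw [h₁, h₄, Pi.add_apply, h₂, h₃, h₅', map_add]

theorem coordLp_sub (s : Bool) (φ ψ : L2R σ) :
    coordLp s (φ - ψ) = coordLp s φ - coordLp s ψ :=
  eq_sub_of_add_eq (by rw [← coordLp_add, sub_add_cancel])

theorem coordLp_smul (s : Bool) (A : Bicomplex) (φ : L2R σ) :
    coordLp s (A • φ) = coord s A • coordLp s φ := by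
  refine Lp.ext ?_
  filter_upwards [coordLp_ae_eq s (A • φ), coordLp_ae_eq s φ,
    Lp.coeFn_smul (coord s A) (coordLp s φ), AEEqFun.coeFn_smul A φ.1] with x h₁ h₂ h₃ h₄
  have h₄' : (A • φ).1 x = A * φ.1 x := h₄
  rw [h₁, h₃, Pi.smul_apply, h₂, h₄', coord_mul, smul_eq_mul]

theorem ext_coordLp {φ ψ : L2R σ} (h : ∀ s, coordLp s φ = coordLp s ψ) : φ = ψ := by
  refine Subtype.ext (AEEqFun.ext ?_)
  have hs : ∀ s, ∀ᵐ x ∂(gaussR σ), coord s (φ.1 x) = coord s (ψ.1 x) := fun s => by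
    have h' := coordLp_ae_eq s φ
    rw [h s] at h'
    exact h'.symm.trans (coordLp_ae_eq s ψ)
  filter_upwards [hs true, hs false] with x h₁ h₂
  exact ext_coord fun s => by cases s <;> assumption

theorem exists_coordLp_eq (v : Bool → Lp ℂ 2 (gaussR σ)) : ∃ φ : L2R σ, ∀ s, coordLp s φ = v s := by
  have hm : MemLp (fun x => ofCoord fun s => v s x) 2 (gaussR σ) :=
    memLp_of_coord fun s => by simpa using Lp.memLp (v s)
  have hae := AEEqFun.coeFn_mk _ hm.1
  refine ⟨⟨AEEqFun.mk _ hm.1, (memLp_congr_ae hae).2 hm⟩, fun s => Lp.ext ?_⟩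
  refine (coordLp_ae_eq s _).trans ?_
  filter_upwards [hae] with x hx
  rw [hx, coord_ofCoord]

/-- With c = √(ν/(4σ)), one has 2σc = √(σν) and σc² = ν/4. Expanding the square therefore splits off
the Gaussian weight and leaves the conjugate of a coherent state. -/
theorem coord_sbIntegrand (hσ : 0 < σ) (hν : 0 < ν) (φ : ℝ → Bicomplex) (Z : Bicomplex)
    (s : Bool) (x : ℝ) :
    √(σ / Real.pi) • coord s (sbIntegrand σ ν φ Z x) = (√(σ / Real.pi) * Real.exp (-σ * x ^ 2)) •
      (coord s (φ x) * Complex.exp (√(σ * ν) * coord s Z * x + -(ν / 4 * coord s Z ^ 2))) := by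
  have hroot : 2 * σ * √(ν / (4 * σ)) = √(σ * ν) := by
    rw [show σ * ν = (2 * σ) ^ 2 * (ν / (4 * σ)) by field_simp; ring,
      Real.sqrt_mul (by positivity), Real.sqrt_sq (by positivity)]
  have hroot' : 2 * (σ : ℂ) * (√(ν / (4 * σ)) : ℝ) = (√(σ * ν) : ℝ) := by
    rw [← hroot]
    push_cast
    ring
  have hsq : (σ : ℂ) * ((√(ν / (4 * σ)) : ℝ) : ℂ) ^ 2 = ν / 4 := by
    have hσ' : (σ : ℂ) ≠ 0 := by exact_mod_cast hσ.ne'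
    rw [← Complex.ofReal_pow, Real.sq_sqrt (by positivity)]
    push_cast
    field_simp
  have hexp : Complex.exp (-σ * x ^ 2) *
      Complex.exp (√(σ * ν) * coord s Z * x + -(ν / 4 * coord s Z ^ 2)) =
      Complex.exp (-(σ * (x - (√(ν / (4 * σ)) : ℝ) * coord s Z) ^ 2)) := by
    rw [← Complex.exp_add]
    congr 1
    linear_combination (-(coord s Z * x)) * hroot' + coord s Z ^ 2 * hsq
  simp only [sbIntegrand, coord_mul, coord_exp, map_neg, coord_real_smul, coord_pow, map_sub,
    coord_one, mul_one, ← hexp, Complex.real_smul]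
  push_cast
  ring

theorem integrable_sbIntegrand (hσ : 0 < σ) (hν : 0 < ν) (φ : L2R σ) (Z : Bicomplex) :
    Integrable (sbIntegrand σ ν φ.1 Z) := by
  refine integrable_of_coord fun s => ?_
  have h := (memLp_coord s φ.2).integrable_mul (memLp_cexp_linear_gaussR hσ
    (√(σ * ν) * coord s Z) (-(ν / 4 * coord s Z ^ 2)))
  have h' := integrable_gaussR.1 h
  simp only [Pi.mul_apply, ← coord_sbIntegrand hσ hν] at h'
  exact (integrable_smul_iff (by positivity : √(σ / Real.pi) ≠ 0) _).1 h'

theorem coord_segalBargmann (hσ : 0 < σ) (hν : 0 < ν) (φ : L2R σ) (Z : Bicomplex) (s : Bool) :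
    coord s (segalBargmann σ ν φ.1 Z) = bargmann hσ ν (coordLp s φ) (coord s Z) := by
  rw [segalBargmann, coord_real_smul, coord_integral s (integrable_sbIntegrand hσ hν φ Z),
    ← Complex.real_smul, ← integral_smul, bargmann_eq_integral]
  simp only [coord_sbIntegrand hσ hν]
  rw [← integral_gaussR]
  refine integral_congr_ae ?_
  filter_upwards [coordLp_ae_eq s φ] with x hx
  rw [hx]

/-- The bicomplex Segal–Bargmann transform as a linear map. -/
def segalBargmannLinear (hσ : 0 < σ) (hν : 0 < ν) : L2R σ →ₗ[Bicomplex] BargmannBC ν where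
  toFun φ := ⟨segalBargmann σ ν φ.1,
    Holomorphic.of_entire (fun s => differentiable_bargmann hσ hν (coordLp s φ))
      fun s Z => coord_segalBargmann hσ hν φ Z s,
    memLp_of_coord fun s => by
      simpa only [coord_segalBargmann hσ hν] using memLp_bargmann hσ hν s (coordLp s φ)⟩
  map_add' φ ψ := Subtype.ext <| funext fun Z => ext_coord fun s => by
    have h : coord s (segalBargmann σ ν (φ + ψ).1 Z) =
        coord s (segalBargmann σ ν φ.1 Z + segalBargmann σ ν ψ.1 Z) := by
      rw [map_add, coord_segalBargmann hσ hν, coord_segalBargmann hσ hν, coord_segalBargmann hσ hν,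
        coordLp_add, bargmann_add, Pi.add_apply]
    exact h
  map_smul' A φ := Subtype.ext <| funext fun Z => ext_coord fun s => by
    have h : coord s (segalBargmann σ ν (A • φ).1 Z) =
        coord s (A * segalBargmann σ ν φ.1 Z) := by
      rw [coord_mul, coord_segalBargmann hσ hν, coord_segalBargmann hσ hν,
        coordLp_smul, bargmann_smul, Pi.smul_apply, smul_eq_mul]
    exact h

theorem coord_segalBargmannLinear (hσ : 0 < σ) (hν : 0 < ν) (φ : L2R σ) (Z : Bicomplex)
    (s : Bool) :
    coord s ((segalBargmannLinear hσ hν φ).1 Z) = bargmann hσ ν (coordLp s φ) (coord s Z) :=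
  coord_segalBargmann hσ hν φ Z s

theorem segalBargmannLinear_bijective (hσ : 0 < σ) (hν : 0 < ν) :
    Function.Bijective (segalBargmannLinear (σ := σ) (ν := ν) hσ hν) := by
  refine ⟨fun φ ψ h => ext_coordLp fun s => bargmann_injective hσ hν (funext fun a => ?_),
    fun f => ?_⟩
  · have h' := coord_segalBargmannLinear hσ hν φ (ofCoord fun _ => a) s
    rw [h, coord_segalBargmannLinear, coord_ofCoord] at h'
    exact h'.symm
  -- The preimage is assembled from the adjoints applied to the two entire components.
  · obtain ⟨F, hF, hfF⟩ := f.2.1.exists_entire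
    have hL : ∀ s, MemLp (fun Z => F s (coord s Z)) 2 (gaussBC ν) := fun s => by
      simpa only [hfF] using memLp_coord s f.2.2
    obtain ⟨φ, hφ⟩ := exists_coordLp_eq fun s => bargmannAdjoint hσ hν s ((hL s).toLp _)
    refine ⟨φ, Subtype.ext (funext fun Z => ext_coord fun s => ?_)⟩
    rw [coord_segalBargmannLinear, hφ, bargmann_bargmannAdjoint hσ hν s (hF s), hfF]

/-- The bicomplex Segal–Bargmann transform as a linear equivalence. -/
def segalBargmannEquiv (hσ : 0 < σ) (hν : 0 < ν) : L2R σ ≃ₗ[Bicomplex] BargmannBC ν :=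
  LinearEquiv.ofBijective _ (segalBargmannLinear_bijective hσ hν)

theorem coord_eq_bargmann (hσ : 0 < σ) (hν : 0 < ν) (f : BargmannBC ν) (Z : Bicomplex)
    (s : Bool) :
    coord s (f.1 Z)
      = bargmann hσ ν (coordLp s ((segalBargmannEquiv hσ hν).symm f)) (coord s Z) := by
  rw [← coord_segalBargmannLinear hσ hν]
  exact congrArg (fun g : BargmannBC ν => coord s (g.1 Z))
    ((segalBargmannEquiv hσ hν).apply_symm_apply f).symm

/-- With each coordinate of f written as an isometric image, preservation of inner products and
norms by the inverse can be read off. -/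
theorem toLp_coord_eq (hσ : 0 < σ) (hν : 0 < ν) (f : BargmannBC ν) (s : Bool) :
    (memLp_coord s f.2.2).toLp _
      = bargmannIso hσ hν s (coordLp s ((segalBargmannEquiv hσ hν).symm f)) := by
  rw [← toLp_bargmann]
  refine MemLp.toLp_congr _ _ (Eventually.of_forall fun Z => ?_)
  exact coord_eq_bargmann hσ hν f Z s

/-- Unlike the inverse, the adjoint is defined on all of L², so it also applies to the cutoffs of f
to balls, which need not be holomorphic. -/
theorem coordLp_symm_eq (hσ : 0 < σ) (hν : 0 < ν) (f : BargmannBC ν) (s : Bool) :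
    coordLp s ((segalBargmannEquiv hσ hν).symm f)
      = bargmannAdjoint hσ hν s ((memLp_coord s f.2.2).toLp _) := by
  rw [toLp_coord_eq hσ hν, ← toLp_bargmann, bargmannAdjoint_bargmann]

theorem coord_bcInner {X : Type*} [MeasurableSpace X] {μ : Measure X} {f g : X → Bicomplex}
    (hf : MemLp f 2 μ) (hg : MemLp g 2 μ) (s : Bool) :
    coord s (bcInner μ f g)
      = inner ℂ ((memLp_coord s hg).toLp _) ((memLp_coord s hf).toLp _) := by
  have hint : Integrable (fun x => f x * conj (g x)) μ := integrable_of_coord fun s => by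
    simp only [coord_mul, coord_conj]
    exact (memLp_coord s hf).integrable_mul (memLp_coord s hg).star
  rw [bcInner, coord_integral s hint, inner_toLp]
  simp only [coord_mul, coord_conj]

theorem bcInner_symm (hσ : 0 < σ) (hν : 0 < ν) (f g : BargmannBC ν) :
    bcInner (gaussR σ) ((segalBargmannEquiv hσ hν).symm f).1 ((segalBargmannEquiv hσ hν).symm g).1
      = bcInner (gaussBC ν) f.1 g.1 := by
  refine ext_coord fun s => ?_
  rw [coord_bcInner f.2.2 g.2.2, toLp_coord_eq hσ hν, toLp_coord_eq hσ hν,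
    LinearIsometry.inner_map_map]
  exact coord_bcInner ((segalBargmannEquiv hσ hν).symm f).2 ((segalBargmannEquiv hσ hν).symm g).2 s

theorem eLpNorm_coord_symm (hσ : 0 < σ) (hν : 0 < ν) (f : BargmannBC ν) (s : Bool) :
    eLpNorm (fun x => coord s (((segalBargmannEquiv hσ hν).symm f).1 x)) 2 (gaussR σ)
      = eLpNorm (fun Z => coord s (f.1 Z)) 2 (gaussBC ν) := by
  rw [← eLpNorm_congr_ae (coordLp_ae_eq s _), ← Lp.enorm_def,
    ← (bargmannIso hσ hν s).enorm_map, ← toLp_coord_eq hσ hν, Lp.enorm_def,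
    eLpNorm_congr_ae (MemLp.coeFn_toLp _)]

theorem eLpNorm_symm (hσ : 0 < σ) (hν : 0 < ν) (f : BargmannBC ν) :
    eLpNorm ((segalBargmannEquiv hσ hν).symm f).1 2 (gaussR σ) = eLpNorm f.1 2 (gaussBC ν) := by
  refine (ENNReal.pow_right_strictMono two_ne_zero).injective ?_
  rw [eLpNorm_sq_eq_coord f.2.2.1, eLpNorm_sq_eq_coord (AEEqFun.aestronglyMeasurable _),
    eLpNorm_coord_symm, eLpNorm_coord_symm]

theorem coord_invIntegrand (σ ν : ℝ) (f : Bicomplex → Bicomplex) (x : ℝ) (Z : Bicomplex)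
    (s : Bool) :
    coord s (invIntegrand σ ν f x Z)
      = Real.exp (-ν * ‖Z‖ ^ 2) • (kernelFun σ ν (coord s Z) x * coord s (f Z)) := by
  simp only [invIntegrand, coord_mul, coord_exp, map_add, map_sub, map_neg, coord_real_smul,
    coord_pow, coord_conj, coord_one, kernelFun, Complex.real_smul, mul_one]
  rw [← mul_assoc, Complex.ofReal_exp, ← Complex.exp_add]
  congr 2
  push_cast
  ring

theorem continuous_invIntegrand (σ ν : ℝ) {f : Bicomplex → Bicomplex} (hf : Continuous f) (x : ℝ) :
    Continuous (invIntegrand σ ν f x) := by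
  have h : invIntegrand σ ν f x = fun Z => ofCoord fun s =>
      Real.exp (-ν * ‖Z‖ ^ 2) • (kernelFun σ ν (coord s Z) x * coord s (f Z)) :=
    funext fun Z => ext_coord fun s => by rw [coord_ofCoord, coord_invIntegrand]
  rw [h]
  refine continuous_ofCoord.comp (continuous_pi fun s => ?_)
  unfold kernelFun
  fun_prop

theorem integrableOn_invIntegrand_ball (σ ν : ℝ) {f : Bicomplex → Bicomplex} (hf : Continuous f)
    (R x : ℝ) : IntegrableOn (invIntegrand σ ν f x) (Metric.ball 0 R) :=
  ((continuous_invIntegrand σ ν hf x).continuousOn.integrableOn_compact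
    (isCompact_closedBall 0 R)).mono_set Metric.ball_subset_closedBall

theorem coord_invIntegral {f : Bicomplex → Bicomplex} {S : Set Bicomplex} (hS : MeasurableSet S)
    {x : ℝ} (hi : IntegrableOn (invIntegrand σ ν f x) S) (s : Bool) :
    coord s (invIntegral σ ν f S x) = ∫ Z, kernelFun σ ν (coord s Z) x *
      S.indicator (fun Z => coord s (f Z)) Z ∂(gaussBC ν) := by
  rw [invIntegral, coord_real_smul, coord_integral s hi, ← Complex.real_smul, ← integral_smul,
    integral_gaussBC, ← integral_indicator hS]
  refine integral_congr_ae (Eventually.of_forall fun Z => ?_)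
  by_cases hZ : Z ∈ S
  · simp only [Set.indicator_of_mem hZ, coord_invIntegrand, smul_smul]
  · simp only [Set.indicator_of_notMem hZ, mul_zero, smul_zero]

theorem coord_invIntegral_ball_ae_eq (hσ : 0 < σ) (hν : 0 < ν) (f : BargmannBC ν) (R : ℝ)
    (s : Bool) :
    (fun x => coord s (invIntegral σ ν f.1 (Metric.ball 0 R) x)) =ᵐ[gaussR σ]
      bargmannAdjoint hσ hν s
        (((memLp_coord s f.2.2).indicator Metric.isOpen_ball.measurableSet).toLp
          ((Metric.ball 0 R).indicator fun Z => coord s (f.1 Z))) := by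
  refine EventuallyEq.trans (Eventually.of_forall fun x => ?_)
    (bargmannAdjoint_ae_eq hσ hν s _ (R := R) fun Z hZ => ?_).symm
  · exact coord_invIntegral Metric.isOpen_ball.measurableSet
      (integrableOn_invIntegrand_ball σ ν f.2.1.continuous R x) s
  · exact Set.indicator_of_notMem (by simpa using hZ) _

theorem memLp_invIntegral_ball (hσ : 0 < σ) (hν : 0 < ν) (f : BargmannBC ν) (R : ℝ) :
    MemLp (invIntegral σ ν f.1 (Metric.ball 0 R)) 2 (gaussR σ) :=
  memLp_of_coord fun s =>
    (memLp_congr_ae (coord_invIntegral_ball_ae_eq hσ hν f R s)).2 (Lp.memLp _)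

/-- The error is the adjoint applied to f minus its cutoff, and the adjoint is a contraction. -/
theorem eLpNorm_coord_symm_sub_invIntegral_le (hσ : 0 < σ) (hν : 0 < ν) (f : BargmannBC ν)
    (R : ℝ) (s : Bool) :
    eLpNorm (fun x => coord s (((segalBargmannEquiv hσ hν).symm f).1 x -
        invIntegral σ ν f.1 (Metric.ball 0 R) x)) 2 (gaussR σ)
      ≤ eLpNorm ((fun Z => coord s (f.1 Z)) -
        (Metric.ball 0 R).indicator fun Z => coord s (f.1 Z)) 2 (gaussBC ν) := by
  have hL := memLp_coord s f.2.2
  have hLR := hL.indicator (Metric.isOpen_ball (x := (0 : Bicomplex)) (ε := R)).measurableSet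
  have hae : (fun x => coord s (((segalBargmannEquiv hσ hν).symm f).1 x -
        invIntegral σ ν f.1 (Metric.ball 0 R) x)) =ᵐ[gaussR σ]
      bargmannAdjoint hσ hν s (hL.toLp _ - hLR.toLp _) := by
    rw [map_sub, ← coordLp_symm_eq hσ hν f s]
    filter_upwards [coordLp_ae_eq s ((segalBargmannEquiv hσ hν).symm f),
      coord_invIntegral_ball_ae_eq hσ hν f R s, Lp.coeFn_sub
      (coordLp s ((segalBargmannEquiv hσ hν).symm f)) (bargmannAdjoint hσ hν s (hLR.toLp _))]
      with x h₁ h₂ h₃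
    rw [h₃, Pi.sub_apply, h₁, ← h₂, map_sub]
  rw [eLpNorm_congr_ae hae, ← Lp.enorm_def, ← MemLp.toLp_sub,
    ← eLpNorm_congr_ae (MemLp.coeFn_toLp (hL.sub hLR)), ← Lp.enorm_def]
  exact enorm_le_iff_norm_le.2 (norm_bargmannAdjoint_le hσ hν s _)

theorem tendsto_eLpNorm_symm_sub_invIntegral (hσ : 0 < σ) (hν : 0 < ν) (f : BargmannBC ν) :
    Tendsto (fun R : ℝ => eLpNorm (fun x => ((segalBargmannEquiv hσ hν).symm f).1 x -
      invIntegral σ ν f.1 (Metric.ball 0 R) x) 2 (gaussR σ)) atTop (𝓝 0) := by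
  have hlim : Tendsto (fun R : ℝ =>
      eLpNorm ((fun Z => coord true (f.1 Z)) -
        (Metric.ball 0 R).indicator fun Z => coord true (f.1 Z)) 2 (gaussBC ν) +
      eLpNorm ((fun Z => coord false (f.1 Z)) -
        (Metric.ball 0 R).indicator fun Z => coord false (f.1 Z)) 2 (gaussBC ν)) atTop (𝓝 0) := by
    simpa using (memLp_coord true f.2.2).tendsto_eLpNorm_sub_indicator_ball.add
      (memLp_coord false f.2.2).tendsto_eLpNorm_sub_indicator_ball
  refine tendsto_of_tendsto_of_tendsto_of_le_of_le tendsto_const_nhds hlim (fun _ => zero_le)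
    fun R => ?_
  refine (eLpNorm_le_coord ?_).trans (add_le_add
    (eLpNorm_coord_symm_sub_invIntegral_le hσ hν f R true)
    (eLpNorm_coord_symm_sub_invIntegral_le hσ hν f R false))
  exact (AEEqFun.aestronglyMeasurable _).sub (memLp_invIntegral_ball hσ hν f R).1

/-- Along a subsequence of integer radii the ball integrals converge almost everywhere to the
inverse transform. Where the full integral converges absolutely they also converge to it, so the two
limits agree. -/
theorem symm_ae_eq_invIntegral (hσ : 0 < σ) (hν : 0 < ν) (f : BargmannBC ν) :
    ∀ᵐ x : ℝ, Integrable (invIntegrand σ ν f.1 x) →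
      ((segalBargmannEquiv hσ hν).symm f).1 x = invIntegral σ ν f.1 Set.univ x := by
  have hlim := (tendsto_eLpNorm_symm_sub_invIntegral hσ hν f).comp
    (tendsto_natCast_atTop_atTop (R := ℝ))
  have hmeas : TendstoInMeasure (gaussR σ)
      (fun (n : ℕ) => invIntegral σ ν f.1 (Metric.ball 0 (n : ℝ))) atTop
      ((segalBargmannEquiv hσ hν).symm f).1 := by
    refine tendstoInMeasure_of_tendsto_eLpNorm two_ne_zero
      (fun n => (memLp_invIntegral_ball hσ hν f n).1) (AEEqFun.aestronglyMeasurable _) ?_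
    refine hlim.congr fun n => ?_
    exact eLpNorm_sub_comm _ _ _ _
  obtain ⟨ns, hns, hae⟩ := hmeas.exists_seq_tendsto_ae
  filter_upwards [(volume_absolutelyContinuous_gaussR hσ).ae_le hae] with x hx hi
  have hball : Tendsto (fun n : ℕ => ∫ Z in Metric.ball (0 : Bicomplex) (n : ℝ),
      invIntegrand σ ν f.1 x Z) atTop (𝓝 (∫ Z in Set.univ, invIntegrand σ ν f.1 x Z)) := by
    have hU : ⋃ n : ℕ, Metric.ball (0 : Bicomplex) (n : ℝ) = Set.univ := Metric.iUnion_ball_nat 0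
    rw [← hU]
    refine tendsto_setIntegral_of_monotone (fun n => Metric.isOpen_ball.measurableSet)
      (fun m n hmn => Metric.ball_subset_ball (by exact_mod_cast hmn)) ?_
    rw [hU]
    exact hi.integrableOn
  exact tendsto_nhds_unique hx ((hball.const_smul ((ν / Real.pi) ^ 2)).comp hns.tendsto_atTop)

/-- The coherent state grows at most like e^(ν|ζ|²/4) up to a factor exponential in |ζ|, where ζ is
the coordinate of Z. As |ζ|² ≤ 2‖Z‖², this consumes only half of the decay e^(−ν‖Z‖²), while the
transform of a coherent state adds linear growth in the exponent. -/
theorem integrable_kernelFun_mul_bargmann (hσ : 0 < σ) (hν : 0 < ν) (s : Bool) (x : ℝ)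
    {ψ : Lp ℂ 2 (gaussR σ)} (hψ : ψ ∈ Submodule.span ℂ (Set.range (kernel hσ ν))) :
    Integrable fun Z : Bicomplex => Real.exp (-ν * ‖Z‖ ^ 2) •
      (kernelFun σ ν (coord s Z) x * bargmann hσ ν ψ (coord s Z)) := by
  refine Submodule.span_induction (p := fun ψ _ => Integrable fun Z : Bicomplex =>
    Real.exp (-ν * ‖Z‖ ^ 2) • (kernelFun σ ν (coord s Z) x * bargmann hσ ν ψ (coord s Z)))
    ?_ ?_ (fun φ ψ _ _ h₁ h₂ => ?_) (fun c φ _ h => ?_) hψ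
  · rintro _ ⟨b, rfl⟩
    -- This is twice the coefficient √(σν)|x| + ν‖b‖/2 of |ζ|, because |ζ| ≤ 2‖Z‖.
    set C := 2 * √(σ * ν) * |x| + ν * ‖b‖ with hC
    refine (integrable_rexp_neg_mul_sq_norm_add (half_pos hν) C).mono' ?_
      (Eventually.of_forall fun Z => ?_)
    · have : Continuous fun Z : Bicomplex => Real.exp (-ν * ‖Z‖ ^ 2) •
          (kernelFun σ ν (coord s Z) x * bargmann hσ ν (kernel hσ ν b) (coord s Z)) := by
        rw [bargmann_kernel hσ hν]
        unfold kernelFun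
        fun_prop
      exact this.aestronglyMeasurable
    · have h₁ := norm_kernelFun_le_exp (σ := σ) hν (coord s Z) x
      have h₂ : ‖bargmann hσ ν (kernel hσ ν b) (coord s Z)‖
          ≤ Real.exp (ν / 2 * ‖b‖ * ‖coord s Z‖) := by
        rw [bargmann_kernel hσ hν, Complex.norm_exp, Real.exp_le_exp]
        refine (Complex.re_le_norm _).trans_eq ?_
        simp [abs_of_pos hν]
      rw [norm_smul, norm_mul, Real.norm_of_nonneg (Real.exp_pos _).le]
      calc _ ≤ Real.exp (-ν * ‖Z‖ ^ 2) *
            (Real.exp (√(σ * ν) * ‖coord s Z‖ * |x| + ν / 4 * ‖coord s Z‖ ^ 2) *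
              Real.exp (ν / 2 * ‖b‖ * ‖coord s Z‖)) := by gcongr
        _ ≤ _ := by
          rw [← Real.exp_add, ← Real.exp_add, Real.exp_le_exp]
          have h3 := mul_le_mul_of_nonneg_left (norm_coord_sq_le s Z) (by positivity : 0 ≤ ν / 4)
          have h4 := mul_le_mul_of_nonneg_left (norm_coord_le s Z)
            (by positivity : 0 ≤ √(σ * ν) * |x| + ν / 2 * ‖b‖)
          rw [hC]
          linarith
  · simp [bargmann_zero]
  · refine (h₁.add h₂).congr (Eventually.of_forall fun Z => ?_)
    simp only [Pi.add_apply, bargmann_add, mul_add, smul_add]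
  · refine (h.const_mul c).congr (Eventually.of_forall fun Z => ?_)
    simp only [bargmann_smul, Pi.smul_apply, smul_eq_mul, Complex.real_smul]
    ring

/-- The approximation is made on the line, by combinations of coherent states within ε/2 in each
coordinate, and carried over isometrically. -/
theorem exists_integrable_invIntegrand_approx (hσ : 0 < σ) (hν : 0 < ν) (f : BargmannBC ν) {ε : ℝ}
    (hε : 0 < ε) :
    ∃ g : BargmannBC ν, eLpNorm (f.1 - g.1) 2 (gaussBC ν) < ENNReal.ofReal ε ∧
      ∀ x : ℝ, Integrable (invIntegrand σ ν g.1 x) := by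
  set B := segalBargmannEquiv (σ := σ) (ν := ν) hσ hν with hB
  have hd := Submodule.dense_iff_topologicalClosure_eq_top.2 (span_kernel_dense hσ hν)
  have hex : ∀ s, ∃ ψ ∈ Submodule.span ℂ (Set.range (kernel hσ ν)),
      dist (coordLp s (B.symm f)) ψ < ε / 2 := fun s => hd.exists_dist_lt _ (half_pos hε)
  choose ψ hψ hdist using hex
  obtain ⟨χ, hχ⟩ := exists_coordLp_eq ψ
  have hcoord : ∀ s Z, coord s ((B χ).1 Z) = bargmann hσ ν (ψ s) (coord s Z) := fun s Z => by
    rw [← hχ s]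
    exact coord_segalBargmannLinear hσ hν χ Z s
  refine ⟨B χ, ?_, fun x => integrable_of_coord fun s => ?_⟩
  · have hnorm : ∀ s, eLpNorm (fun Z => coord s ((f.1 - (B χ).1) Z)) 2 (gaussBC ν)
        < ENNReal.ofReal (ε / 2) := fun s => by
      have h := eLpNorm_coord_symm hσ hν (f - B χ) s
      rw [← hB, map_sub, LinearEquiv.symm_apply_apply] at h
      refine h.symm.trans_lt ?_
      rw [← eLpNorm_congr_ae (coordLp_ae_eq s _), ← Lp.enorm_def, coordLp_sub, hχ, ← ofReal_norm,
        ENNReal.ofReal_lt_ofReal_iff (half_pos hε), ← dist_eq_norm]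
      exact hdist s
    refine (eLpNorm_le_coord (f.2.2.1.sub (B χ).2.2.1)).trans_lt ?_
    refine (ENNReal.add_lt_add (hnorm true) (hnorm false)).trans_eq ?_
    rw [← ENNReal.ofReal_add (by positivity) (by positivity), add_halves]
  · simp only [coord_invIntegrand, hcoord]
    exact integrable_kernelFun_mul_bargmann hσ hν s x (hψ s)

end SegalBargmann

end

theorem mainTheorem4 (σ ν : ℝ) (hσ : 0 < σ) (hν : 0 < ν) :
    ∃ B : L2R σ ≃ₗ[Bicomplex] BargmannBC ν,
      -- `B` is the bicomplex Segal–Bargmann transform, given by a convergent integral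
      (∀ (φ : L2R σ) (Z : Bicomplex), Integrable (sbIntegrand σ ν φ.1 Z) ∧
        (B φ).1 Z = segalBargmann σ ν φ.1 Z) ∧
      -- its inverse is unitary
      (∀ f g : BargmannBC ν,
        bcInner (gaussR σ) (B.symm f).1 (B.symm g).1 = bcInner (gaussBC ν) f.1 g.1) ∧
      (∀ f : BargmannBC ν, eLpNorm (B.symm f).1 2 (gaussR σ) = eLpNorm f.1 2 (gaussBC ν)) ∧
      -- the integral formula, with the integral over all bicomplex numbers understood as the
      -- limit in mean of the integrals over the balls `|Z| < R`
      (∀ f : BargmannBC ν,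
        (∀ (R : ℝ) (x : ℝ), IntegrableOn (invIntegrand σ ν f.1 x) (Metric.ball 0 R)) ∧
        (∀ R : ℝ, MemLp (invIntegral σ ν f.1 (Metric.ball 0 R)) 2 (gaussR σ)) ∧
        Tendsto (fun R : ℝ => eLpNorm (fun x =>
            (B.symm f).1 x - invIntegral σ ν f.1 (Metric.ball 0 R) x) 2 (gaussR σ))
          atTop (𝓝 0)) ∧
      -- the integral formula with an absolutely convergent integral, almost everywhere where
      -- the integral converges absolutely
      (∀ f : BargmannBC ν, ∀ᵐ x : ℝ, Integrable (invIntegrand σ ν f.1 x) →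
        (B.symm f).1 x = invIntegral σ ν f.1 Set.univ x) ∧
      -- which happens at every `x` for a dense set of `f`
      (∀ (f : BargmannBC ν) (ε : ℝ), 0 < ε → ∃ g : BargmannBC ν,
        eLpNorm (f.1 - g.1) 2 (gaussBC ν) < ENNReal.ofReal ε ∧
        ∀ x : ℝ, Integrable (invIntegrand σ ν g.1 x)) := by
  refine ⟨SegalBargmann.segalBargmannEquiv hσ hν,
    fun φ Z => ⟨SegalBargmann.integrable_sbIntegrand hσ hν φ Z, rfl⟩,
    SegalBargmann.bcInner_symm hσ hν, SegalBargmann.eLpNorm_symm hσ hν,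
    fun f => ⟨SegalBargmann.integrableOn_invIntegrand_ball σ ν f.2.1.continuous,
      SegalBargmann.memLp_invIntegral_ball hσ hν f,
      SegalBargmann.tendsto_eLpNorm_symm_sub_invIntegral hσ hν f⟩,
    SegalBargmann.symm_ae_eq_invIntegral hσ hν,
    fun f ε hε => SegalBargmann.exists_integrable_invIntegrand_approx hσ hν f hε⟩
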